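/- For $y,\omega\in\mathbb R^d$ and $f\in L^2(\mathbb R^d)$ let $T_yf(x)=f(x-y)$ and $M_\omega f(x)=e^{2\pi i\langle x,\omega\rangle}f(x)$. For $\sigma\in\mathbb Z^d/(2\mathbb Z^d)$, identified with its representative in $\{0,1\}^d$, let $R_\sigma x=((-1)^{\sigma_1}x_1,\dots,(-1)^{\sigma_d}x_d)$ and $\operatorname{supp}\sigma=\{j:\sigma_j\equiv 1 \bmod 2\}$. Let $G\subset\mathbb Z^d/(2\mathbb Z^d)$ be a separable subgroup with $k\ge 0$ generators, i.e. $G$ is generated by elements $\sigma^1,\dots,\sigma^k$ whose supports $S_i=\operatorname{supp}\sigma^i$ are non-empty and pairwise disjoint. Let $\Lambda=\bigcup_{\sigma\in G}(\sigma+2\mathbb Z^d)$ and $2\Lambda^\perp=\{\alpha\in\mathbb Z^d:\langle\alpha,\lambda\rangle\in 2\mathbb Z\ \ \forall\lambda\in\Lambda\}$. Let $I:G\to\widehat G\cong\mathbb Z^d/(2\Lambda^\perp)$ be the canonical isomorphism, i.e. the group homomorphism determined by $\langle I(\sigma^i),\sigma^j\rangle\equiv\delta_{i,j}\bmod 2$,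 where elements of $\mathbb Z^d/(2\Lambda^\perp)$ are identified with an arbitrary fixed choice of coset representatives in $\mathbb Z^d$. Write $\operatorname{orbit}(x)=\{R_\sigma x:\sigma\in G\}$, let $N\subset\mathbb Z^d$ satisfy $|N\cap\operatorname{orbit}(x)|=1$ for all $x\in\mathbb Z^d$, and put $c_\gamma=2^{-k}|\operatorname{orbit}(\gamma)|^{1/2}$ for $\gamma\in N$. Let $g\in L^2(\mathbb R^d)$ have a real-valued Fourier transform, $\hat g(\omega)=\overline{\hat g(\omega)}$ for a.e. $\omega$, and be separable with respect to $G$: with $S_0=\{1,\dots,d\}\setminus\bigcup_{i=1}^kS_i$ there are functions $g_i:\mathbb R^{|S_i|}\to\mathbb C$, $i=0,\dots,k$, such that $g(x)=\prod_{i=0}^kg_i((x_j)_{j\in S_i})$ for a.e. $x\in\mathbb R^d$. Let $\mathcal W(g,G)$ be the Wilson system consisting of the functions $$T_\lambda T_{\frac12h}\,c_\gamma\sum_{\sigma\in G}(-1)^{\langle I(h)+\gamma,\sigma\rangle}M_{R_\sigma\gamma}\,g,\qquad \lambda\in\mathbb Z^d,\ h\in G,\ \gamma\in N,$$ regarded as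 a family indexed by $(\lambda,h,\gamma)$ from which the members that are identically zero are discarded. If $\mathcal W(g,G)=\{\psi_j\}_{j\in J}$ is a frame for $L^2(\mathbb R^d)$ with bounds $a,b>0$, i.e. $a\|f\|^2\le\sum_{j\in J}|\langle f,\psi_j\rangle|^2\le b\|f\|^2$ for all $f\in L^2(\mathbb R^d)$, then $\mathcal W(g,G)$ is a Riesz basis for $L^2(\mathbb R^d)$ with the same bounds $a$ and $b$, i.e. its linear span is dense in $L^2(\mathbb R^d)$ and $a\sum_{j}|c_j|^2\le\big\|\sum_{j}c_j\psi_j\big\|^2\le b\sum_{j}|c_j|^2$ for all finitely supported scalar families $(c_j)_{j\in J}$. -/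

import Mathlib

open MeasureTheory FourierTransform

noncomputable section

namespace Wilson

/-! ### Frames and Riesz bases in a Hilbert space -/

section Frames

variable {ι H : Type*} [NormedAddCommGroup H] [InnerProductSpace ℂ H]

/-- The family `f` is a frame for `H` with (lower and upper) bounds `a` and `b`. -/
def IsFrame (f : ι → H) (a b : ℝ) : Prop :=
  0 < a ∧ 0 < b ∧ ∀ x : H,
    Summable (fun i => ‖inner ℂ (f i) x‖ ^ 2) ∧
    a * ‖x‖ ^ 2 ≤ ∑' i, ‖inner ℂ (f i) x‖ ^ 2 ∧
    ∑' i, ‖inner ℂ (f i) x‖ ^ 2 ≤ b * ‖x‖ ^ 2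

/-- The family `f` is a Riesz basis for `H` with (lower and upper) bounds `a` and `b`: it is
complete, and the two-sided estimate holds for all finitely supported coefficient families. -/
def IsRieszBasis (f : ι → H) (a b : ℝ) : Prop :=
  0 < a ∧ 0 < b ∧
    (Submodule.span ℂ (Set.range f)).topologicalClosure = ⊤ ∧
    ∀ c : ι →₀ ℂ,
      a * (∑ i ∈ c.support, ‖c i‖ ^ 2) ≤ ‖∑ i ∈ c.support, c i • f i‖ ^ 2 ∧
      ‖∑ i ∈ c.support, c i • f i‖ ^ 2 ≤ b * (∑ i ∈ c.support, ‖c i‖ ^ 2)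

end Frames

/-! ### Translations and modulations on `L²(ℝᵈ)` -/

/-- The Euclidean space `ℝᵈ`. -/
abbrev Rd (d : ℕ) : Type := EuclideanSpace ℝ (Fin d)

/-- The Hilbert space `L²(ℝᵈ)` of complex-valued functions. -/
abbrev L2 (d : ℕ) : Type := Lp ℂ 2 (volume : Measure (Rd d))

/-- The translation operator `(T_y f)(x) = f(x - y)`. -/
def translation {d : ℕ} (y : Rd d) (f : L2 d) : L2 d :=
  Lp.compMeasurePreserving (fun x => x - y) (measurePreserving_sub_right volume y) f

theorem memLp_modulation {d : ℕ} (ω : Rd d) (f : L2 d) :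
    MemLp (fun x => Complex.exp (2 * Real.pi * Complex.I * (inner ℝ x ω : ℝ)) * f x) 2
      (volume : Measure (Rd d)) := by
  refine (Lp.memLp f).of_le ?_ ?_
  · refine AEStronglyMeasurable.mul ?_ (Lp.aestronglyMeasurable f)
    exact Continuous.aestronglyMeasurable (by fun_prop)
  · refine Filter.Eventually.of_forall fun x => ?_
    have h : ‖Complex.exp (2 * Real.pi * Complex.I * (inner ℝ x ω : ℝ))‖ = 1 := by
      rw [show (2 * Real.pi * Complex.I * (inner ℝ x ω : ℝ) : ℂ)
        = ((2 * Real.pi * inner ℝ x ω : ℝ) : ℂ) * Complex.I by push_cast; ring]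
      exact Complex.norm_exp_ofReal_mul_I _
    rw [norm_mul, h, one_mul]

/-- The modulation operator `(M_ω f)(x) = e^{2πi⟨x, ω⟩} f(x)`. -/
def modulation {d : ℕ} (ω : Rd d) (f : L2 d) : L2 d :=
  (memLp_modulation ω f).toLp _

/-- The vector of `ℝᵈ` with the given integer coordinates. -/
def intVec {d : ℕ} (n : Fin d → ℤ) : Rd d := WithLp.toLp 2 fun j => (n j : ℝ)

/-! ### Separable groups and separable functions

The group `ℤᵈ/2ℤᵈ` is `Fin d → ZMod 2`; its coset representatives in `{0,1}ᵈ` are obtained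
from `ZMod.val`. -/

/-- The coset representative in `{0,1}ᵈ ⊆ ℤᵈ` of an element of `ℤᵈ/2ℤᵈ`. -/
def rep {d : ℕ} (σ : Fin d → ZMod 2) : Fin d → ℤ := fun j => ((σ j).val : ℤ)

/-- The support `{j : σ_j ≡ 1 mod 2}`. -/
def supp {d : ℕ} (σ : Fin d → ZMod 2) : Set (Fin d) := {j | σ j = 1}

/-- `σ 0, …, σ (k-1)` are non-trivial generators with pairwise disjoint supports of the
subgroup `G` of `ℤᵈ/2ℤᵈ`; thus `G` is a separable group with `k` generators. -/
structure IsSeparableGroup {d k : ℕ} (G : AddSubgroup (Fin d → ZMod 2))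
    (σ : Fin k → Fin d → ZMod 2) : Prop where
  closure_eq : AddSubgroup.closure (Set.range σ) = G
  supp_nonempty : ∀ i, (supp (σ i)).Nonempty
  supp_disjoint : ∀ i j, i ≠ j → Disjoint (supp (σ i)) (supp (σ j))

/-- The coordinate projection of `ℝᵈ` onto the coordinates in `S`. -/
def proj {d : ℕ} (S : Set (Fin d)) (x : Rd d) : S → ℝ := fun j => x j

/-- The function `g` is separable with respect to the separable group generated by `σ`:
almost everywhere it is a product of functions of the coordinates in `S i = supp (σ i)` and of a
function of the coordinates in the complement of the union of all `S i`. -/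
def IsSeparableFun {d k : ℕ} (σ : Fin k → Fin d → ZMod 2) (g : Rd d → ℂ) : Prop :=
  ∃ (g₀ : (((⋃ i, supp (σ i))ᶜ : Set (Fin d)) → ℝ) → ℂ)
    (g₁ : (i : Fin k) → (supp (σ i) → ℝ) → ℂ),
    ∀ᵐ x : Rd d, g x = g₀ (proj _ x) * ∏ i, g₁ i (proj _ x)

/-! ### The duality map -/

/-- For the lattice `Λ = ⋃_{σ ∈ G} (σ + 2ℤᵈ)` this is the lattice
`2Λ^⊥ = {α ∈ ℤᵈ : ⟨α, v⟩ is even for all v ∈ Λ}`. -/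
def twoDualLattice {d : ℕ} (G : AddSubgroup (Fin d → ZMod 2)) : Set (Fin d → ℤ) :=
  {α | ∀ v : Fin d → ℤ, (fun j => (v j : ZMod 2)) ∈ G → Even (α ⬝ᵥ v)}

/-- `I : G → ℤᵈ` picks coset representatives modulo `2Λ^⊥` for the canonical isomorphism of `G`
onto its dual group `ℤᵈ/2Λ^⊥`, that is, for the homomorphism determined by
`⟨I(σ i), σ j⟩ ≡ δ_{ij} mod 2`. -/
structure IsDualityMap {d k : ℕ} (G : AddSubgroup (Fin d → ZMod 2))
    (σ : Fin k → Fin d → ZMod 2) (I : G → Fin d → ℤ) : Prop where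
  map_add : ∀ h h' : G, I (h + h') - (I h + I h') ∈ twoDualLattice G
  pairing : ∀ (i j : Fin k) (hi : σ i ∈ G),
    I ⟨σ i, hi⟩ ⬝ᵥ rep (σ j) ≡ (if i = j then 1 else 0) [ZMOD 2]

/-- Such a map exists for every separable group. -/
theorem exists_isDualityMap {d k : ℕ} {G : AddSubgroup (Fin d → ZMod 2)}
    {σ : Fin k → Fin d → ZMod 2} (hG : IsSeparableGroup G σ) :
    ∃ I : G → Fin d → ℤ, IsDualityMap G σ I := by
  choose n hn using hG.supp_nonempty
  have key : ∀ (c : Fin k → ℤ) (v : Fin d → ℤ),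
      (∑ i, Pi.single (n i) (c i) : Fin d → ℤ) ⬝ᵥ v = ∑ i, c i * v (n i) := by
    intro c v
    rw [sum_dotProduct]
    exact Finset.sum_congr rfl fun i _ => by rw [single_dotProduct]
  refine ⟨fun h => ∑ i, Pi.single (n i) (rep h.1 (n i)), ⟨?_, ?_⟩⟩
  · intro h h' v _
    rw [sub_dotProduct, add_dotProduct, key, key, key, ← Finset.sum_add_distrib,
      ← Finset.sum_sub_distrib]
    refine Finset.even_sum _ fun i _ => ?_
    rw [← add_mul, ← sub_mul]
    refine Even.mul_right ?_ _
    have : ∀ x y : ZMod 2, Even (((x + y).val : ℤ) - ((x.val : ℤ) + (y.val : ℤ))) := by decide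
    exact this _ _
  · intro i j hi
    have h01 : ∀ l m, σ l (n m) = if l = m then 1 else 0 := by
      intro l m
      split_ifs with h
      · subst h; exact hn l
      · have h1 : n m ∉ supp (σ l) := fun hm =>
          Set.disjoint_left.1 (hG.supp_disjoint l m h) hm (hn m)
        have h2 : ∀ x : ZMod 2, x ≠ 1 → x = 0 := by decide
        exact h2 _ h1
    have : (∑ m, Pi.single (n m) (rep (σ i) (n m)) : Fin d → ℤ) ⬝ᵥ rep (σ j)
        = if i = j then 1 else 0 := by
      rw [key, Finset.sum_eq_single i]
      · simp only [rep, h01, eq_comm (a := j) (b := i)]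
        split_ifs <;> simp [ZMod.val_one]
      · intro m _ hm
        simp [rep, h01, hm.symm]
      · simp
    show (∑ m, Pi.single (n m) (rep (σ i) (n m)) : Fin d → ℤ) ⬝ᵥ rep (σ j) ≡ _ [ZMOD 2]
    rw [this]

/-! ### Reflections, orbits and the Wilson system -/

/-- The reflection `R_σ n = ((-1)^{σ_1} n_1, …, (-1)^{σ_d} n_d)` on `ℤᵈ`. -/
def reflection {d : ℕ} (σ : Fin d → ZMod 2) (n : Fin d → ℤ) : Fin d → ℤ :=
  fun j => (-1) ^ (σ j).val * n j

/-- The orbit of `n` under `G`. -/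
def orbit {d : ℕ} (G : AddSubgroup (Fin d → ZMod 2)) (n : Fin d → ℤ) : Set (Fin d → ℤ) :=
  {m | ∃ σ ∈ G, m = reflection σ n}

open Classical in
/-- The function
`T_l T_{h/2} c_γ ∑_{σ ∈ G} (-1)^{⟨I(h) + γ, σ⟩} M_{R_σ γ} g`, `c_γ = 2^{-k} |orbit(γ)|^{1/2}`. -/
def wilsonFun {d : ℕ} (k : ℕ) (G : AddSubgroup (Fin d → ZMod 2)) (I : G → Fin d → ℤ)
    (g : L2 d) (l : Fin d → ℤ) (h : G) (γ : Fin d → ℤ) : L2 d :=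
  translation (intVec l) (translation ((1 / 2 : ℝ) • intVec (rep h.1))
    ((((2 : ℝ) ^ k)⁻¹ * √((orbit G γ).ncard : ℝ) : ℂ) •
      ∑ σ : G, (-1 : ℂ) ^ ((I h + γ) ⬝ᵥ rep σ.1) • modulation (intVec (reflection σ.1 γ)) g))

/-- The Wilson system: the family of all functions `wilsonFun k G I g l h γ` with `l ∈ ℤᵈ`,
`h ∈ G`, `γ ∈ N`, where the members that are the zero function are disregarded. -/
def wilsonSystem {d : ℕ} (k : ℕ) (G : AddSubgroup (Fin d → ZMod 2)) (I : G → Fin d → ℤ)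
    (N : Set (Fin d → ℤ)) (g : L2 d) :
    {p : (Fin d → ℤ) × G × N // wilsonFun k G I g p.1 p.2.1 p.2.2.1 ≠ 0} → L2 d :=
  fun p => wilsonFun k G I g p.1.1 p.1.2.1 p.1.2.2.1

end Wilson

end

/-! Everything is carried to the frequency domain. With `u = 𝓕 g` the Wilson functions become sums
of integer translates of `u` multiplied by characters, and the frame operator `F` is studied through
its matrix coefficients between functions supported on single unit cubes `n + (0,1]ᵈ` and `m +
(0,1]ᵈ`.

Parseval on a cube performs the sum over `l`, orthogonality of the characters of `G` performs the
sum over `h`, and orbit counting unfolds `N` to `ℤᵈ`. What remains (`hasSum_wilsonHat`) is a sum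
over `γ ∈ ℤᵈ` of signs times correlations of `u` at `n - γ` and `m - R_ρ γ`, where `ρ = rho σ (n +
m)`.

Separability and reality enter only to show that exchanging the coordinates in one `supp (σ i)`
between the two shifts does not change these correlations. If `ρ ≠ 0`, an involution of `γ` performs
such an exchange and reverses the sign, so the coefficient vanishes
(`IsWilsonOperator.inner_eq_zero`). Hence `F` couples only cubes with `ρ = 0`, where its
coefficients are those of a Gabor frame operator. It therefore commutes with the translations and
modulations that build the system, and `F⁻¹` maps the Wilson system of `u` to that of `F⁻¹ u`.

The same unfolding with the two windows `F⁻¹ u` and `u` gives Wexler–Raz relations on even shifts,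
from which `⟨ψ, F⁻¹ ψ⟩ = 1` for every nonzero member `ψ`. For a frame this forces biorthogonality
with the canonical dual, hence the Riesz property with the same bounds (`IsFrame.isRieszBasis`).

The exchange invariance is obtained from that of `g ⊗ g`, which is immediate from the product form.
It passes to `u ⊗ u` by Gaussian regularisation and uniqueness of characteristic functions, and then
by Fubini to the null set of pairs `(ξ + n, ξ + m)`. -/

noncomputable section

namespace Wilson

/-! ### Sign characters and reflections modulo 2. -/

section Signs

/-- The sign character of `ℤ/2ℤ`. -/
def sgn (a : ZMod 2) : ℂ := if a = 0 then 1 else -1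

@[simp] theorem sgn_zero : sgn 0 = 1 := by simp [sgn]

@[simp] theorem sgn_one : sgn 1 = -1 := by simp [sgn]

theorem sgn_add (a b : ZMod 2) : sgn (a + b) = sgn a * sgn b := by
  revert a b
  have : ∀ a : ZMod 2, a = 0 ∨ a = 1 := by decide
  intro a b
  rcases this a with rfl | rfl <;> rcases this b with rfl | rfl <;>
    simp [sgn, show (1 + 1 : ZMod 2) = 0 by decide]

@[simp] theorem conj_sgn (a : ZMod 2) : (starRingEnd ℂ) (sgn a) = sgn a := by
  unfold sgn; split_ifs <;> simp

theorem neg_one_zpow_eq_sgn (n : ℤ) : (-1 : ℂ) ^ n = sgn (n : ZMod 2) := by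
  rcases Int.even_or_odd n with h | h
  · rw [h.neg_one_zpow, (ZMod.intCast_zmod_eq_zero_iff_dvd n 2).2 h.two_dvd, sgn_zero]
  · rw [h.neg_one_zpow]
    obtain ⟨m, rfl⟩ := h
    push_cast
    rw [show (2 : ZMod 2) = 0 from rfl, zero_mul, zero_add, sgn_one]

variable {d : ℕ}

/-- The pairing of `ℤᵈ` and `ℤᵈ/2ℤᵈ` modulo `2`. -/
def dot2 (n : Fin d → ℤ) (τ : Fin d → ZMod 2) : ZMod 2 := ∑ j, (n j : ZMod 2) * τ j

theorem rep_cast (τ : Fin d → ZMod 2) : (fun j => ((rep τ j : ℤ) : ZMod 2)) = τ := by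
  ext j; simp [rep]

theorem cast_dotProduct (n v : Fin d → ℤ) :
    ((n ⬝ᵥ v : ℤ) : ZMod 2) = dot2 n (fun j => (v j : ZMod 2)) := by
  simp [dotProduct, dot2]

theorem cast_dotProduct_rep (n : Fin d → ℤ) (τ : Fin d → ZMod 2) :
    ((n ⬝ᵥ rep τ : ℤ) : ZMod 2) = dot2 n τ := by
  rw [cast_dotProduct, rep_cast]

theorem dot2_add_left (n m : Fin d → ℤ) (τ : Fin d → ZMod 2) :
    dot2 (n + m) τ = dot2 n τ + dot2 m τ := by
  simp [dot2, add_mul, Finset.sum_add_distrib]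

theorem dot2_add_right (n : Fin d → ℤ) (τ τ' : Fin d → ZMod 2) :
    dot2 n (τ + τ') = dot2 n τ + dot2 n τ' := by
  simp [dot2, mul_add, Finset.sum_add_distrib]

@[simp] theorem dot2_zero_right (n : Fin d → ℤ) : dot2 n 0 = 0 := by simp [dot2]

theorem dot2_sum_right {κ : Type*} (s : Finset κ) (n : Fin d → ℤ) (τ : κ → Fin d → ZMod 2) :
    dot2 n (∑ i ∈ s, τ i) = ∑ i ∈ s, dot2 n (τ i) := by
  simp only [dot2, Finset.sum_apply, Finset.mul_sum]
  exact Finset.sum_comm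

theorem dot2_smul_right (n : Fin d → ℤ) (c : ZMod 2) (τ : Fin d → ZMod 2) :
    dot2 n (c • τ) = c * dot2 n τ := by
  simp only [dot2, Finset.mul_sum, Pi.smul_apply, smul_eq_mul]
  exact Finset.sum_congr rfl fun j _ => by ring

theorem dot2_congr {n m : Fin d → ℤ} (h : ∀ j, (n j : ZMod 2) = m j) (τ : Fin d → ZMod 2) :
    dot2 n τ = dot2 m τ := by
  simp [dot2, h]

theorem add_self_eq_zero_of_two (τ : Fin d → ZMod 2) : τ + τ = 0 :=
  funext fun j => CharTwo.add_self_eq_zero (τ j)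

theorem reflection_apply (σ : Fin d → ZMod 2) (n : Fin d → ℤ) (j : Fin d) :
    reflection σ n j = if σ j = 0 then n j else -n j := by
  unfold reflection
  have : ∀ a : ZMod 2, a = 0 ∨ a = 1 := by decide
  rcases this (σ j) with h | h <;> simp [h, ZMod.val_one]

theorem reflection_cast (σ : Fin d → ZMod 2) (n : Fin d → ℤ) (j : Fin d) :
    ((reflection σ n j : ℤ) : ZMod 2) = n j := by
  rw [reflection_apply]; split_ifs <;> simp

theorem dot2_reflection (σ τ : Fin d → ZMod 2) (n : Fin d → ℤ) :
    dot2 (reflection σ n) τ = dot2 n τ :=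
  dot2_congr (reflection_cast σ n) τ

theorem reflection_add (σ τ : Fin d → ZMod 2) (n : Fin d → ℤ) :
    reflection (σ + τ) n = reflection σ (reflection τ n) := by
  ext j
  simp only [reflection_apply, Pi.add_apply]
  have : ∀ a : ZMod 2, a = 0 ∨ a = 1 := by decide
  rcases this (σ j) with h | h <;> rcases this (τ j) with h' | h' <;>
    simp [h, h', show (1 + 1 : ZMod 2) = 0 by decide]

@[simp] theorem reflection_zero (n : Fin d → ℤ) : reflection 0 n = n := by
  ext j; simp [reflection_apply]

theorem reflection_reflection (σ : Fin d → ZMod 2) (n : Fin d → ℤ) :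
    reflection σ (reflection σ n) = n := by
  rw [← reflection_add, add_self_eq_zero_of_two, reflection_zero]

end Signs

/-! ### Coordinates on a separable group and its character duality. -/

section Group

variable {d k : ℕ} {G : AddSubgroup (Fin d → ZMod 2)} {σ : Fin k → Fin d → ZMod 2}

/-- The linear combination of the generators with the given coefficients. -/
def comb (σ : Fin k → Fin d → ZMod 2) (c : Fin k → ZMod 2) : Fin d → ZMod 2 := ∑ i, c i • σ i

theorem comb_add (c c' : Fin k → ZMod 2) : comb σ (c + c') = comb σ c + comb σ c' := by
  simp [comb, add_smul, Finset.sum_add_distrib]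

theorem IsSeparableGroup.mem (hG : IsSeparableGroup G σ) (i : Fin k) : σ i ∈ G := by
  rw [← hG.closure_eq]; exact AddSubgroup.subset_closure ⟨i, rfl⟩

theorem IsSeparableGroup.comb_mem (hG : IsSeparableGroup G σ) (c : Fin k → ZMod 2) :
    comb σ c ∈ G := by
  refine AddSubgroup.sum_mem _ fun i _ => ?_
  have : ∀ a : ZMod 2, a = 0 ∨ a = 1 := by decide
  rcases this (c i) with h | h
  · rw [h, zero_smul]; exact G.zero_mem
  · rw [h, one_smul]; exact hG.mem i

theorem IsSeparableGroup.apply_of_ne (hG : IsSeparableGroup G σ) {i l : Fin k} (h : l ≠ i)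
    {j : Fin d} (hj : j ∈ supp (σ i)) : σ l j = 0 := by
  have h1 : j ∉ supp (σ l) := fun hm => Set.disjoint_left.1 (hG.supp_disjoint l i h) hm hj
  have h2 : ∀ x : ZMod 2, x ≠ 1 → x = 0 := by decide
  exact h2 _ h1

theorem IsSeparableGroup.comb_apply (hG : IsSeparableGroup G σ) (c : Fin k → ZMod 2) {i : Fin k}
    {j : Fin d} (hj : j ∈ supp (σ i)) : comb σ c j = c i := by
  have h1 : σ i j = 1 := hj
  rw [comb, Finset.sum_apply, Finset.sum_eq_single i]
  · simp [h1]
  · intro l _ hl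
    simp [hG.apply_of_ne hl hj]
  · simp

theorem IsSeparableGroup.exists_comb (hG : IsSeparableGroup G σ) {τ : Fin d → ZMod 2}
    (hτ : τ ∈ G) : ∃ c, comb σ c = τ := by
  rw [← hG.closure_eq] at hτ
  induction hτ using AddSubgroup.closure_induction with
  | mem x hx =>
    obtain ⟨i, rfl⟩ := hx
    refine ⟨Pi.single i 1, ?_⟩
    rw [comb, Finset.sum_eq_single i]
    · simp
    · intro l _ hl; simp [hl]
    · simp
  | zero => exact ⟨0, by simp [comb]⟩
  | add x y _ _ hx hy =>
    obtain ⟨c, rfl⟩ := hx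
    obtain ⟨c', rfl⟩ := hy
    exact ⟨c + c', comb_add c c'⟩
  | neg x _ hx =>
    obtain ⟨c, rfl⟩ := hx
    exact ⟨c, (neg_eq_of_add_eq_zero_left (add_self_eq_zero_of_two _)).symm⟩

theorem IsSeparableGroup.comb_injective (hG : IsSeparableGroup G σ) :
    Function.Injective (comb σ) := by
  intro c c' h
  ext i
  obtain ⟨j, hj⟩ := hG.supp_nonempty i
  rw [← hG.comb_apply c hj, ← hG.comb_apply c' hj, h]

theorem IsSeparableGroup.card_eq (hG : IsSeparableGroup G σ) : Nat.card G = 2 ^ k := by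
  have : Function.Bijective (fun c => (⟨comb σ c, hG.comb_mem c⟩ : G)) := by
    refine ⟨fun c c' h => hG.comb_injective (Subtype.ext_iff.1 h), fun τ => ?_⟩
    obtain ⟨c, hc⟩ := hG.exists_comb τ.2
    exact ⟨c, Subtype.ext hc⟩
  rw [← Nat.card_eq_of_bijective _ this]
  simp

variable {I : G → Fin d → ℤ}

theorem IsDualityMap.dot2_add (hI : IsDualityMap G σ I) (h h' τ : G) :
    dot2 (I (h + h')) τ.1 = dot2 (I h) τ.1 + dot2 (I h') τ.1 := by
  have h1 := hI.map_add h h' (rep τ.1) (by rw [rep_cast]; exact τ.2)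
  have h2 : ((((I (h + h') - (I h + I h')) ⬝ᵥ rep τ.1 : ℤ)) : ZMod 2) = 0 :=
    (ZMod.intCast_zmod_eq_zero_iff_dvd _ 2).2 h1.two_dvd
  rw [sub_dotProduct, add_dotProduct] at h2
  push_cast at h2
  rw [cast_dotProduct_rep, cast_dotProduct_rep, cast_dotProduct_rep] at h2
  exact sub_eq_zero.1 h2

theorem IsDualityMap.dot2_pairing (hI : IsDualityMap G σ I) (i j : Fin k) (hi : σ i ∈ G) :
    dot2 (I ⟨σ i, hi⟩) (σ j) = if i = j then 1 else 0 := by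
  have := (ZMod.intCast_eq_intCast_iff _ _ 2).2 (hI.pairing i j hi)
  rw [cast_dotProduct_rep] at this
  rw [this]; split_ifs <;> simp

theorem IsDualityMap.dot2_comb (hI : IsDualityMap G σ I) (i : Fin k) (hi : σ i ∈ G)
    (c : Fin k → ZMod 2) : dot2 (I ⟨σ i, hi⟩) (comb σ c) = c i := by
  rw [comb, dot2_sum_right, Finset.sum_eq_single i]
  · rw [dot2_smul_right, hI.dot2_pairing, if_pos rfl, mul_one]
  · intro l _ hl
    rw [dot2_smul_right, hI.dot2_pairing, if_neg hl.symm, mul_zero]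
  · simp

/-- The element of `G` that represents the character `h ↦ (-1)^{⟨n, h⟩}` of `G`. -/
def rho (σ : Fin k → Fin d → ZMod 2) (n : Fin d → ℤ) : Fin d → ZMod 2 :=
  comb σ fun i => dot2 n (σ i)

/-- Both sides are additive in `h`, so generators suffice; there the left side reads off a
coefficient of `rho σ n`. This turns the phase produced by the half-integer translation into a
character of `h` of the same kind as those in the Wilson sums. -/
theorem IsDualityMap.dot2_rho (hG : IsSeparableGroup G σ) (hI : IsDualityMap G σ I)
    (n : Fin d → ℤ) (h : G) : dot2 (I h) (rho σ n) = dot2 n h.1 := by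
  have hr : rho σ n ∈ G := hG.comb_mem _
  obtain ⟨τ, hτ⟩ := h
  have hτ' := hτ
  rw [← hG.closure_eq] at hτ'
  induction hτ' using AddSubgroup.closure_induction with
  | mem x hx =>
    obtain ⟨i, rfl⟩ := hx
    rw [rho, hI.dot2_comb]
  | zero =>
    -- The representative of `I 0` need not be `0`; additivity at `0 + 0` forces its pairing with
    -- `G` to vanish.
    have := hI.dot2_add 0 0 ⟨_, hr⟩
    exact left_eq_add.1 ((congrArg (fun t => dot2 (I t) (rho σ n)) (add_zero (0 : G))).symm.trans this) |>.trans (dot2_zero_right n).symm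
  | add x y hx hy ihx ihy =>
    rw [hG.closure_eq] at hx hy
    have := hI.dot2_add ⟨x, hx⟩ ⟨y, hy⟩ ⟨_, hr⟩
    rw [dot2_add_right, ← ihx hx, ← ihy hy, ← this]
    rfl
  | neg x hx ih =>
    have hneg : -x = x := neg_eq_of_add_eq_zero_left (add_self_eq_zero_of_two _)
    simp only [hneg]
    rw [hG.closure_eq] at hx
    exact ih hx

theorem rho_congr {n m : Fin d → ℤ} (h : ∀ j, (n j : ZMod 2) = m j) : rho σ n = rho σ m := by
  simp [rho, dot2_congr h]

/-- Orthogonality of characters: if `κ` has a nonzero coefficient at `σ i`, shifting `h` by `σ i`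
negates every term. -/
theorem IsDualityMap.sum_sgn (hG : IsSeparableGroup G σ) (hI : IsDualityMap G σ I)
    [Fintype G] {κ : Fin d → ZMod 2} (hκ : κ ∈ G) :
    ∑ h : G, sgn (dot2 (I h) κ) = if κ = 0 then 2 ^ k else 0 := by
  split_ifs with h0
  · subst h0
    simp only [dot2_zero_right, sgn_zero, Finset.sum_const, Finset.card_univ, nsmul_eq_mul, mul_one]
    rw [← Nat.card_eq_fintype_card, hG.card_eq]
    norm_num
  · obtain ⟨c, rfl⟩ := hG.exists_comb hκ
    have : ∃ i, c i ≠ 0 := by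
      by_contra hc
      push Not at hc
      exact h0 (by simp [comb, hc])
    obtain ⟨i, hi⟩ := this
    have hi1 : c i = 1 := (by decide : ∀ x : ZMod 2, x ≠ 0 → x = 1) _ hi
    have h2 : ∑ h : G, sgn (dot2 (I h) (comb σ c))
        = ∑ h : G, sgn (dot2 (I (h + ⟨σ i, hG.mem i⟩)) (comb σ c)) :=
      (Equiv.sum_comp (Equiv.addRight (⟨σ i, hG.mem i⟩ : G)) _).symm
    have h3 : ∀ h : G, sgn (dot2 (I (h + ⟨σ i, hG.mem i⟩)) (comb σ c))
        = - sgn (dot2 (I h) (comb σ c)) := fun h => by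
      have := hI.dot2_add h ⟨σ i, hG.mem i⟩ ⟨_, hκ⟩
      simp only at this
      rw [this, hI.dot2_comb, hi1, sgn_add, sgn_one, mul_neg_one]
    simp only [h3, Finset.sum_neg_distrib] at h2
    exact self_eq_neg.1 h2

end Group

/-! ### Orbit counting, unfolding of sums over `N`, and the sign-reversing involution. -/

section Orbits

variable {d k : ℕ} {G : AddSubgroup (Fin d → ZMod 2)} {σ : Fin k → Fin d → ZMod 2}

open Classical in
/-- The orbit of `γ` as a finite set. -/
def orbitFinset (G : AddSubgroup (Fin d → ZMod 2)) (γ : Fin d → ℤ) : Finset (Fin d → ℤ) :=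
  Finset.univ.image fun τ : G => reflection τ.1 γ

open Classical in
/-- The stabilizer of `γ` as a finite set. -/
def stabFinset (G : AddSubgroup (Fin d → ZMod 2)) (γ : Fin d → ℤ) : Finset G :=
  Finset.univ.filter fun τ : G => reflection τ.1 γ = γ

theorem mem_stabFinset {γ : Fin d → ℤ} {τ : G} :
    τ ∈ stabFinset G γ ↔ reflection τ.1 γ = γ := by simp [stabFinset]

theorem coe_orbitFinset (γ : Fin d → ℤ) : (orbitFinset G γ : Set (Fin d → ℤ)) = orbit G γ := by
  ext m
  simp only [orbitFinset, Finset.coe_image, Finset.coe_univ, Set.image_univ, Set.mem_range, orbit,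
    Set.mem_ofPred_eq]
  constructor
  · rintro ⟨τ, rfl⟩; exact ⟨τ.1, τ.2, rfl⟩
  · rintro ⟨τ, hτ, rfl⟩; exact ⟨⟨τ, hτ⟩, rfl⟩

theorem ncard_orbit (γ : Fin d → ℤ) : (orbit G γ).ncard = (orbitFinset G γ).card := by
  rw [← coe_orbitFinset, Set.ncard_coe_finset]

open Classical in
theorem card_reflection_fiber (γ : Fin d → ℤ) {m : Fin d → ℤ} (hm : m ∈ orbitFinset G γ) :
    (Finset.univ.filter fun τ : G => reflection τ.1 γ = m).card = (stabFinset G γ).card := by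
  obtain ⟨τ₀, -, rfl⟩ := Finset.mem_image.1 hm
  refine Finset.card_bij' (fun τ _ => τ₀ + τ) (fun τ _ => τ₀ + τ) ?_ ?_ ?_ ?_
  · intro τ hτ
    rw [mem_stabFinset]
    have := (Finset.mem_filter.1 hτ).2
    rw [AddSubgroup.coe_add, reflection_add, this, reflection_reflection]
  · intro τ hτ
    rw [mem_stabFinset] at hτ
    simp [reflection_add, hτ]
  all_goals
    intro τ _
    ext1
    simp [← add_assoc, add_self_eq_zero_of_two]

open Classical in
theorem sum_reflection (γ : Fin d → ℤ) (K : (Fin d → ℤ) → ℂ) :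
    ∑ τ : G, K (reflection τ.1 γ) = (stabFinset G γ).card * ∑ m ∈ orbitFinset G γ, K m := by
  rw [Finset.sum_comp K (fun τ : G => reflection τ.1 γ), Finset.mul_sum]
  refine Finset.sum_congr rfl fun m hm => ?_
  rw [card_reflection_fiber γ hm, nsmul_eq_mul]

theorem IsSeparableGroup.card_stab_mul_card_orbit (hG : IsSeparableGroup G σ) (γ : Fin d → ℤ) :
    ((stabFinset G γ).card : ℂ) * (orbitFinset G γ).card = 2 ^ k := by
  classical
  have h1 := sum_reflection (G := G) γ fun _ => 1
  simp only [Finset.sum_const, nsmul_eq_mul, mul_one, Finset.card_univ] at h1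
  rw [← h1, ← Nat.card_eq_fintype_card, hG.card_eq]
  norm_num

theorem mem_orbit_comm {x y : Fin d → ℤ} (h : x ∈ orbit G y) : y ∈ orbit G x := by
  obtain ⟨τ, hτ, rfl⟩ := h
  exact ⟨τ, hτ, (reflection_reflection τ y).symm⟩

theorem exists_retraction {N : Set (Fin d → ℤ)} (hN : ∀ x, (N ∩ orbit G x).ncard = 1) :
    ∃ r : (Fin d → ℤ) → N, ∀ x γ, r x = γ ↔ x ∈ orbit G γ.1 := by
  have h : ∀ x, ∃ y : N, ∀ z : N, z.1 ∈ orbit G x ↔ z = y := fun x => by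
    obtain ⟨y, hy⟩ := Set.ncard_eq_one.1 (hN x)
    have hyN : y ∈ N ∩ orbit G x := hy ▸ Set.mem_singleton y
    refine ⟨⟨y, hyN.1⟩, fun z => ⟨fun hz => ?_, fun hz => hz ▸ hyN.2⟩⟩
    have : z.1 ∈ N ∩ orbit G x := ⟨z.2, hz⟩
    rw [hy] at this
    exact Subtype.ext this
  choose r hr using h
  refine ⟨r, fun x γ => ⟨fun h => mem_orbit_comm ((hr x γ).2 h.symm), fun h => ?_⟩⟩
  exact ((hr x γ).1 (mem_orbit_comm h)).symm

-- The orbits of the points of `N` partition `ℤᵈ`. Summing over `G` counts each orbit point once per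
-- stabilizer element, and orbit-stabilizer makes the weight `2^{-k}|orbit|` compensate exactly.
-- This weight is `2^k c_γ²`, the factor `2^k` coming from the sum over `h`.
open Classical in
theorem IsSeparableGroup.hasSum_orbit (hG : IsSeparableGroup G σ) {N : Set (Fin d → ℤ)}
    (hN : ∀ x, (N ∩ orbit G x).ncard = 1) {K : (Fin d → ℤ) → ℂ} {s : ℂ} (hK : HasSum K s) :
    HasSum (fun γ : N => ((2 : ℂ) ^ k)⁻¹ * (orbit G γ.1).ncard * ∑ τ : G, K (reflection τ.1 γ)) s := by
  obtain ⟨r, hr⟩ := exists_retraction hN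
  refine (hK.tsum_fiberwise r).congr_fun fun γ => ?_
  have h1 : r ⁻¹' {γ} = ↑(orbitFinset G γ.1) := by
    rw [coe_orbitFinset]; ext x; exact hr x γ
  rw [h1, Finset.tsum_subtype' (orbitFinset G γ.1) K, sum_reflection, ncard_orbit,
    ← hG.card_stab_mul_card_orbit γ.1]
  have h2 := hG.card_stab_mul_card_orbit (G := G) γ.1
  have h3 : ((stabFinset G γ.1).card : ℂ) * (orbitFinset G γ.1).card ≠ 0 := by
    rw [h2]; exact pow_ne_zero k two_ne_zero
  have h4 := left_ne_zero_of_mul h3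
  have h5 := right_ne_zero_of_mul h3
  field_simp

/-- The involution `γ_j ↦ n_j - m_j - γ_j` of the coordinates in `S`. -/
def flip (S : Set (Fin d)) [DecidablePred (· ∈ S)] (n m γ : Fin d → ℤ) : Fin d → ℤ :=
  fun j => if j ∈ S then n j - m j - γ j else γ j

theorem flip_involutive (S : Set (Fin d)) [DecidablePred (· ∈ S)] (n m : Fin d → ℤ) :
    Function.Involutive (flip S n m) := by
  intro γ
  ext j
  unfold flip
  split_ifs <;> ring

/-- On `S` the reflection by `ρ` is `γ ↦ -γ`, so there `n - flip γ = m + γ = m - R_ρ γ`. With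
`sub_reflection_flip`, the involution exchanges the `S`-coordinates of the two shifts and fixes the
others. -/
theorem sub_flip (S : Set (Fin d)) [DecidablePred (· ∈ S)] {ρ : Fin d → ZMod 2}
    (hρ : ∀ j ∈ S, ρ j = 1) (n m γ : Fin d → ℤ) (j : Fin d) :
    (n - flip S n m γ) j = if j ∈ S then (m - reflection ρ γ) j else (n - γ) j := by
  simp only [Pi.sub_apply, flip, reflection_apply]
  split_ifs with h h1
  · simp [hρ j h] at h1
  · ring
  · rfl

theorem sub_reflection_flip (S : Set (Fin d)) [DecidablePred (· ∈ S)] {ρ : Fin d → ZMod 2}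
    (hρ : ∀ j ∈ S, ρ j = 1) (n m γ : Fin d → ℤ) (j : Fin d) :
    (m - reflection ρ (flip S n m γ)) j
      = if j ∈ S then (n - γ) j else (m - reflection ρ γ) j := by
  simp only [Pi.sub_apply, flip, reflection_apply]
  split_ifs with h1 h2
  · simp [hρ j h2] at h1
  all_goals ring

/-- Modulo 2 the involution adds `n + m` to `γ` on `supp (σ i)`, where `rho σ (n + m)` equals 1; the
pairing changes by `dot2 (n + m) (σ i) = 1`. -/
theorem IsSeparableGroup.sgn_flip (hG : IsSeparableGroup G σ) (i : Fin k)
    [DecidablePred (· ∈ supp (σ i))] {n m : Fin d → ℤ} (hi : dot2 (n + m) (σ i) = 1)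
    (γ : Fin d → ℤ) :
    sgn (dot2 (flip (supp (σ i)) n m γ) (rho σ (n + m))) = - sgn (dot2 γ (rho σ (n + m))) := by
  have h1 : dot2 (flip (supp (σ i)) n m γ) (rho σ (n + m))
      = dot2 γ (rho σ (n + m)) + dot2 (n + m) (σ i) := by
    simp only [dot2]
    rw [← Finset.sum_add_distrib]
    refine Finset.sum_congr rfl fun j _ => ?_
    by_cases hj : j ∈ supp (σ i)
    · have h2 : rho σ (n + m) j = 1 := by rw [rho, hG.comb_apply _ hj, hi]
      have h3 : σ i j = 1 := hj
      rw [h2, h3]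
      simp only [flip, hj, if_true, Pi.add_apply]
      push_cast
      simp only [CharTwo.sub_eq_add]
      ring
    · have h3 : σ i j = 0 := (by decide : ∀ x : ZMod 2, x ≠ 1 → x = 0) _ hj
      simp [flip, hj, h3]
  rw [h1, hi, sgn_add, sgn_one, mul_neg_one]

end Orbits

/-! ### Translation and multiplication operators on `L²`. -/

section Operators

variable {d : ℕ}

theorem coeFn_translation (y : Rd d) (f : L2 d) : translation y f =ᵐ[volume] fun x => f (x - y) :=
  Lp.coeFn_compMeasurePreserving _ _

theorem coeFn_modulation (ω : Rd d) (f : L2 d) : modulation ω f =ᵐ[volume] fun x =>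
    Complex.exp (2 * Real.pi * Complex.I * (inner ℝ x ω : ℝ)) * f x :=
  MemLp.coeFn_toLp _

/-- Translation as a linear isometry. -/
def translationL (y : Rd d) : L2 d →ₗᵢ[ℂ] L2 d :=
  Lp.compMeasurePreservingₗᵢ ℂ (fun x => x - y) (measurePreserving_sub_right volume y)

theorem translationL_apply (y : Rd d) (f : L2 d) : translationL y f = translation y f := rfl

theorem ae_comp_sub {p : Rd d → Prop} (h : ∀ᵐ x, p x) (y : Rd d) : ∀ᵐ x, p (x - y) :=
  (measurePreserving_sub_right volume y).quasiMeasurePreserving.ae h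

theorem translation_translation (y z : Rd d) (f : L2 d) :
    translation y (translation z f) = translation (y + z) f := by
  apply Lp.ext
  filter_upwards [coeFn_translation y (translation z f), coeFn_translation (y + z) f,
    ae_comp_sub (coeFn_translation z f) y] with x h1 h2 h3
  rw [h1, h2, h3, sub_sub]

theorem translation_zero (f : L2 d) : translation 0 f = f := by
  apply Lp.ext
  filter_upwards [coeFn_translation 0 f] with x h1
  rw [h1, sub_zero]

theorem inner_translation_translation (y : Rd d) (f g : L2 d) :
    inner ℂ (translation y f) (translation y g) = inner ℂ f g :=
  (translationL y).inner_map_map f g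

theorem inner_translation_left (y : Rd d) (f g : L2 d) :
    inner ℂ (translation y f) g = inner ℂ f (translation (-y) g) := by
  rw [← inner_translation_translation y f, translation_translation, add_neg_cancel,
    translation_zero]

/-- Measurable functions on `ℝᵈ` bounded by `1`. -/
abbrev Mult (d : ℕ) : Type := {φ : Rd d → ℂ // Measurable φ ∧ ∀ x, ‖φ x‖ ≤ 1}

theorem memLp_mult (φ : Mult d) (f : L2 d) : MemLp (fun x => φ.1 x * f x) 2 volume := by
  refine (Lp.memLp f).of_le (φ.2.1.aestronglyMeasurable.mul (Lp.aestronglyMeasurable f))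
    (Filter.Eventually.of_forall fun x => ?_)
  rw [norm_mul]
  exact mul_le_of_le_one_left (norm_nonneg _) (φ.2.2 x)

/-- The multiplication operator by a function bounded by `1`. -/
def mulOp (φ : Mult d) (f : L2 d) : L2 d := (memLp_mult φ f).toLp _

theorem coeFn_mulOp (φ : Mult d) (f : L2 d) : mulOp φ f =ᵐ[volume] fun x => φ.1 x * f x :=
  MemLp.coeFn_toLp _

theorem norm_mulOp_le (φ : Mult d) (f : L2 d) : ‖mulOp φ f‖ ≤ ‖f‖ := by
  refine Lp.norm_le_norm_of_ae_le ?_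
  filter_upwards [coeFn_mulOp φ f] with x hx
  rw [hx, norm_mul]
  exact mul_le_of_le_one_left (norm_nonneg _) (φ.2.2 x)

/-- Multiplication as a linear map. -/
def mulOpL (φ : Mult d) : L2 d →ₗ[ℂ] L2 d where
  toFun := mulOp φ
  map_add' f g := by
    apply Lp.ext
    filter_upwards [coeFn_mulOp φ (f + g), coeFn_mulOp φ f, coeFn_mulOp φ g, Lp.coeFn_add f g,
      Lp.coeFn_add (mulOp φ f) (mulOp φ g)] with x h1 h2 h3 h4 h5
    rw [h1, h5, Pi.add_apply, h2, h3, h4, Pi.add_apply, mul_add]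
  map_smul' c f := by
    apply Lp.ext
    filter_upwards [coeFn_mulOp φ (c • f), coeFn_mulOp φ f, Lp.coeFn_smul c f,
      Lp.coeFn_smul c (mulOp φ f)] with x h1 h2 h3 h4
    rw [h1, RingHom.id_apply, h4, Pi.smul_apply, h2, h3, Pi.smul_apply, smul_eq_mul, smul_eq_mul]
    ring

theorem mulOpL_apply (φ : Mult d) (f : L2 d) : mulOpL φ f = mulOp φ f := rfl

theorem mulOp_smul (φ : Mult d) (c : ℂ) (f : L2 d) : mulOp φ (c • f) = c • mulOp φ f :=
  (mulOpL φ).map_smul c f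

/-- The product of two multipliers. -/
def Mult.mul (φ ψ : Mult d) : Mult d :=
  ⟨fun x => φ.1 x * ψ.1 x, φ.2.1.mul ψ.2.1, fun x => by
    rw [norm_mul]; exact mul_le_one₀ (φ.2.2 x) (norm_nonneg _) (ψ.2.2 x)⟩

/-- The conjugate multiplier. -/
def Mult.conj (φ : Mult d) : Mult d :=
  ⟨fun x => (starRingEnd ℂ) (φ.1 x), RCLike.continuous_conj.measurable.comp φ.2.1, fun x => by
    rw [RCLike.norm_conj]; exact φ.2.2 x⟩

/-- The indicator function of a measurable set as a multiplier. -/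
def Mult.ind (s : Set (Rd d)) (hs : MeasurableSet s) : Mult d :=
  ⟨s.indicator 1, measurable_one.indicator hs, fun x => by
    by_cases h : x ∈ s <;> simp [h]⟩

theorem norm_exp_inner (x y : Rd d) :
    ‖Complex.exp (2 * Real.pi * Complex.I * (inner ℝ x y : ℝ))‖ = 1 := by
  rw [show (2 * Real.pi * Complex.I * (inner ℝ x y : ℝ) : ℂ)
    = ((2 * Real.pi * inner ℝ x y : ℝ) : ℂ) * Complex.I by push_cast; ring]
  exact Complex.norm_exp_ofReal_mul_I _

/-- The character `x ↦ e^{2πi⟨x, y⟩}`. -/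
def Mult.chi (y : Rd d) : Mult d :=
  ⟨fun x => Complex.exp (2 * Real.pi * Complex.I * (inner ℝ x y : ℝ)),
    Continuous.measurable (by fun_prop), fun x => (norm_exp_inner x y).le⟩

/-- The translate `x ↦ φ (x + y)` of a multiplier. -/
def Mult.shift (y : Rd d) (φ : Mult d) : Mult d :=
  ⟨fun x => φ.1 (x + y), φ.2.1.comp (measurable_id.add_const y), fun _ => φ.2.2 _⟩

theorem modulation_eq_mulOp (ω : Rd d) (f : L2 d) : modulation ω f = mulOp (Mult.chi ω) f := rfl

theorem mulOp_mulOp (φ ψ : Mult d) (f : L2 d) : mulOp φ (mulOp ψ f) = mulOp (φ.mul ψ) f := by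
  apply Lp.ext
  filter_upwards [coeFn_mulOp φ (mulOp ψ f), coeFn_mulOp ψ f, coeFn_mulOp (φ.mul ψ) f]
    with x h1 h2 h3
  rw [h1, h2, h3]
  simp only [Mult.mul]; ring

theorem Mult.mul_comm (φ ψ : Mult d) : φ.mul ψ = ψ.mul φ :=
  Subtype.ext (funext fun _ => _root_.mul_comm _ _)

theorem Mult.mul_assoc (φ ψ χ : Mult d) : (φ.mul ψ).mul χ = φ.mul (ψ.mul χ) :=
  Subtype.ext (funext fun _ => _root_.mul_assoc _ _ _)

theorem inner_mulOp_left (φ : Mult d) (f g : L2 d) :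
    inner ℂ (mulOp φ f) g = inner ℂ f (mulOp φ.conj g) := by
  rw [L2.inner_def, L2.inner_def]
  refine integral_congr_ae ?_
  filter_upwards [coeFn_mulOp φ f, coeFn_mulOp φ.conj g] with x h1 h2
  rw [h1, h2]
  simp only [RCLike.inner_apply, map_mul, Mult.conj]
  ring

theorem translation_mulOp (y : Rd d) (φ : Mult d) (f : L2 d) :
    translation (-y) (mulOp φ f) = mulOp (φ.shift y) (translation (-y) f) := by
  apply Lp.ext
  filter_upwards [coeFn_translation (-y) (mulOp φ f), ae_comp_sub (coeFn_mulOp φ f) (-y),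
    coeFn_mulOp (φ.shift y) (translation (-y) f), coeFn_translation (-y) f] with x h1 h2 h3 h4
  rw [h1, h2, h3, h4]
  simp only [Mult.shift, sub_neg_eq_add]

theorem mulOp_chi_shift (y z : Rd d) (f : L2 d) : mulOp ((Mult.chi z).shift y) f =
    Complex.exp (2 * Real.pi * Complex.I * (inner ℝ y z : ℝ)) • mulOp (Mult.chi z) f := by
  apply Lp.ext
  filter_upwards [coeFn_mulOp ((Mult.chi z).shift y) f, coeFn_mulOp (Mult.chi z) f,
    Lp.coeFn_smul (Complex.exp (2 * Real.pi * Complex.I * (inner ℝ y z : ℝ)))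
      (mulOp (Mult.chi z) f)] with x h1 h2 h3
  rw [h1, h3, Pi.smul_apply, h2]
  simp only [Mult.chi, Mult.shift, smul_eq_mul, inner_add_left]
  push_cast
  rw [mul_add, Complex.exp_add]
  ring

theorem Mult.chi_conj (y : Rd d) : (Mult.chi y).conj = Mult.chi (-y) := by
  ext x
  simp only [Mult.conj, Mult.chi, ← Complex.exp_conj]
  congr 1
  simp only [map_mul, Complex.conj_I, Complex.conj_ofReal, inner_neg_right, map_ofNat]
  push_cast; ring

theorem Mult.conj_conj (φ : Mult d) : φ.conj.conj = φ := by ext x; simp [Mult.conj]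

theorem Mult.conj_mul (φ ψ : Mult d) : (φ.mul ψ).conj = φ.conj.mul ψ.conj := by
  ext x; simp [Mult.conj, Mult.mul]

theorem Mult.chi_mul_chi (y z : Rd d) : (Mult.chi y).mul (Mult.chi z) = Mult.chi (y + z) := by
  ext x
  simp only [Mult.mul, Mult.chi, ← Complex.exp_add, inner_add_right]
  congr 1
  push_cast; ring

theorem mulOp_chi_zero (f : L2 d) : mulOp (Mult.chi 0) f = f := by
  apply Lp.ext
  filter_upwards [coeFn_mulOp (Mult.chi 0) f] with x h
  rw [h]; simp [Mult.chi]

theorem inner_mulOp_chi (y : Rd d) (f g : L2 d) :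
    inner ℂ (mulOp (Mult.chi y) f) (mulOp (Mult.chi y) g) = inner ℂ f g := by
  rw [inner_mulOp_left, mulOp_mulOp, Mult.chi_conj, Mult.chi_mul_chi, neg_add_cancel,
    mulOp_chi_zero]

end Operators

/-! ### Tiling of `ℝᵈ` by integer translates of the unit cube. -/

section Tiling

variable {d : ℕ}

/-- The unit cube `(0, 1]ᵈ`. -/
def cube (d : ℕ) : Set (Rd d) := {x | ∀ j, x j ∈ Set.Ioc (0 : ℝ) 1}

theorem measurableSet_cube : MeasurableSet (cube d) := by
  have : cube d = ⋂ j, (fun x : Rd d => x j) ⁻¹' Set.Ioc (0 : ℝ) 1 := by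
    ext x; simp [cube]
  rw [this]
  exact MeasurableSet.iInter fun j => measurableSet_Ioc.preimage (by fun_prop)

theorem volume_cube : volume (cube d) = 1 := by
  have h := (PiLp.volume_preserving_ofLp (Fin d)).measure_preimage
    (s := Set.univ.pi fun _ : Fin d => Set.Ioc (0 : ℝ) 1)
    (MeasurableSet.univ_pi fun _ => measurableSet_Ioc).nullMeasurableSet
  have h2 : (WithLp.ofLp ⁻¹' (Set.univ.pi fun _ : Fin d => Set.Ioc (0 : ℝ) 1) : Set (Rd d))
      = cube d := by ext x; simp [cube]
  rw [h2] at h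
  rw [h, Real.volume_pi_Ioc]
  simp

theorem existsUnique_cube (x : Rd d) : ∃! n : Fin d → ℤ, x + intVec n ∈ cube d := by
  -- The cube is open on the left and closed on the right, hence the ceiling: `x j + n j ∈ (0, 1]`
  -- means `⌈x j⌉ = 1 - n j`.
  refine ⟨fun j => 1 - ⌈x j⌉, fun j => ?_, fun m hm => ?_⟩
  · simp only [intVec, PiLp.add_apply, Set.mem_Ioc]
    push_cast
    constructor <;> linarith [Int.le_ceil (x j), Int.ceil_lt_add_one (x j)]
  · funext j
    have := hm j
    simp only [intVec, PiLp.add_apply, Set.mem_Ioc] at this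
    have h : ⌈x j⌉ = 1 - m j := by
      rw [Int.ceil_eq_iff]; push_cast; constructor <;> linarith
    rw [h]; ring

/-- Multiplication by the indicator function of the unit cube. -/
def cubeM (d : ℕ) : Mult d := Mult.ind (cube d) measurableSet_cube

theorem hasSum_cube (f g : L2 d) :
    HasSum (fun n : Fin d → ℤ => inner ℂ (mulOp (cubeM d) (translation (-intVec n) f))
      (mulOp (cubeM d) (translation (-intVec n) g))) (inner ℂ f g) := by
  have hint := L2.integrable_inner (𝕜 := ℂ) f g
  let s : (Fin d → ℤ) → Set (Rd d) := fun n => {x | x - intVec n ∈ cube d}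
  have hs : ∀ n, MeasurableSet (s n) := fun n =>
    measurableSet_cube.preimage (measurable_id.sub_const _)
  have hdisj : Pairwise (Function.onFun Disjoint s) := by
    intro n m hnm
    refine Set.disjoint_left.2 fun x hn hm => hnm ?_
    have := (existsUnique_cube x).unique (y₁ := -n) (y₂ := -m) ?_ ?_
    · simpa using this
    · have : x + intVec (-n) = x - intVec n := by ext j; simp [intVec, sub_eq_add_neg]
      rw [this]; exact hn
    · have : x + intVec (-m) = x - intVec m := by ext j; simp [intVec, sub_eq_add_neg]
      rw [this]; exact hm
  have hU : (⋃ n, s n) = Set.univ := by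
    refine Set.eq_univ_of_forall fun x => Set.mem_iUnion.2 ?_
    obtain ⟨n, hn, -⟩ := existsUnique_cube x
    refine ⟨-n, ?_⟩
    have : x - intVec (-n) = x + intVec n := by ext j; simp [intVec]
    show x - intVec (-n) ∈ cube d
    rw [this]; exact hn
  have h := hasSum_integral_iUnion hs hdisj (hint.integrableOn (s := ⋃ n, s n))
  rw [hU, setIntegral_univ, ← L2.inner_def] at h
  refine h.congr_fun fun n => ?_
  rw [← inner_translation_translation (intVec n), ← integral_indicator (hs n), L2.inner_def]
  refine integral_congr_ae ?_
  filter_upwards [coeFn_translation (intVec n) (mulOp (cubeM d) (translation (-intVec n) f)),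
    coeFn_translation (intVec n) (mulOp (cubeM d) (translation (-intVec n) g)),
    ae_comp_sub (coeFn_mulOp (cubeM d) (translation (-intVec n) f)) (intVec n),
    ae_comp_sub (coeFn_mulOp (cubeM d) (translation (-intVec n) g)) (intVec n),
    ae_comp_sub (coeFn_translation (-intVec n) f) (intVec n),
    ae_comp_sub (coeFn_translation (-intVec n) g) (intVec n)] with x h1 h2 h3 h4 h5 h6
  rw [h1, h2, h3, h4, h5, h6]
  simp only [sub_neg_eq_add, sub_add_cancel, cubeM, Mult.ind]
  by_cases hx : x ∈ s n
  · have hx' : x - intVec n ∈ cube d := hx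
    simp [hx, hx']
  · have hx' : x - intVec n ∉ cube d := hx
    simp [hx, hx']

end Tiling

/-! ### Fourier series on the cube, transported from the torus. -/

section Parseval

variable {d : ℕ}

/-- The indicator function of the unit cube. -/
def oneQ (d : ℕ) : L2 d :=
  indicatorConstLp 2 measurableSet_cube (by rw [volume_cube]; exact ENNReal.one_ne_top) (1 : ℂ)

theorem coeFn_oneQ : oneQ d =ᵐ[volume] (cube d).indicator fun _ => (1 : ℂ) :=
  indicatorConstLp_coeFn

/-- The normalised Haar measure on the circle. -/
local instance unitAddCircleMeasureSpace : MeasureSpace UnitAddCircle :=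
  ⟨AddCircle.haarAddCircle⟩

/-- The coordinates in `(0, 1]ᵈ` of a point of the torus. -/
def torusToCube (t : UnitAddTorus (Fin d)) : Rd d :=
  WithLp.toLp 2 (UnitAddTorus.measurableEquivPiIoc (fun _ : Fin d => 0) t).1

theorem measurePreserving_torusToCube : MeasurePreserving (torusToCube (d := d)) volume
    (volume.restrict (cube d)) := by
  have h1 := UnitAddTorus.measurePreserving_equivPiIoc (fun _ : Fin d => (0 : ℝ))
  have hms : MeasurableSet {x : Fin d → ℝ | ∀ i, x i ∈ Set.Ioc (0 : ℝ) (0 + 1)} :=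
    MeasurableSet.univ_pi' fun i => measurableSet_Ioc
  have h2 : MeasurePreserving (Subtype.val : {x : Fin d → ℝ // ∀ i, x i ∈ Set.Ioc (0 : ℝ) (0 + 1)}
      → Fin d → ℝ) (Measure.comap Subtype.val volume)
      (volume.restrict {x : Fin d → ℝ | ∀ i, x i ∈ Set.Ioc (0 : ℝ) (0 + 1)}) :=
    ⟨measurable_subtype_coe, map_comap_subtype_coe hms volume⟩
  have h3 := (PiLp.volume_preserving_toLp (Fin d)).restrict_preimage (measurableSet_cube (d := d))
  have h4 : (WithLp.toLp 2 ⁻¹' cube d : Set (Fin d → ℝ))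
      = {x : Fin d → ℝ | ∀ i, x i ∈ Set.Ioc (0 : ℝ) (0 + 1)} := by
    ext x; simp [cube]
  rw [h4] at h3
  exact h3.comp (h2.comp h1)

theorem mFourier_eq (l : Fin d → ℤ) (t : UnitAddTorus (Fin d)) : UnitAddTorus.mFourier l t =
    Complex.exp (2 * Real.pi * Complex.I * (inner ℝ (torusToCube t) (intVec l) : ℝ)) := by
  simp only [UnitAddTorus.mFourier, ContinuousMap.coe_mk]
  have h : ∀ i, fourier (l i) (t i)
      = Complex.exp (2 * Real.pi * Complex.I * ((torusToCube t i * l i : ℝ) : ℂ)) := by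
    intro i
    have h1 : t i = ((torusToCube t i : ℝ) : UnitAddCircle) := by
      have := congrFun ((UnitAddTorus.measurableEquivPiIoc (fun _ : Fin d => (0 : ℝ))).symm_apply_apply t) i
      rw [UnitAddTorus.coe_symm_measurableEquivPiIoc_apply] at this
      exact this.symm
    conv_lhs => rw [h1]
    rw [fourier_coe_apply]
    congr 1
    push_cast; ring
  rw [Finset.prod_congr rfl fun i _ => h i, ← Complex.exp_sum]
  congr 1
  rw [← Finset.mul_sum]
  congr 1
  rw [EuclideanSpace.inner_eq_star_dotProduct]
  simp [dotProduct, intVec, mul_comm]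

theorem memLp_torus (p : L2 d) :
    MemLp (fun t => p (torusToCube t)) 2 (volume : Measure (UnitAddTorus (Fin d))) :=
  ((Lp.memLp p).restrict (cube d)).comp_measurePreserving measurePreserving_torusToCube

theorem inner_exp_oneQ (l : Fin d → ℤ) (q : L2 d) :
    inner ℂ (mulOp (Mult.chi (intVec l)) (oneQ d)) q =
      UnitAddTorus.mFourierCoeff ((memLp_torus q).toLp _) l := by
  have h1 : UnitAddTorus.mFourierCoeff ((memLp_torus q).toLp _) l
      = ∫ t, (fun x : Rd d => (starRingEnd ℂ) (Complex.exp (2 * Real.pi * Complex.I *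
        (inner ℝ x (intVec l) : ℝ))) * q x) (torusToCube t) := by
    refine integral_congr_ae ?_
    filter_upwards [(memLp_torus q).coeFn_toLp] with t ht
    rw [ht, UnitAddTorus.mFourier_neg, mFourier_eq, smul_eq_mul]
  rw [h1, ← integral_map (f := fun x : Rd d => (starRingEnd ℂ) (Complex.exp (2 * Real.pi *
    Complex.I * (inner ℝ x (intVec l) : ℝ))) * q x)
    measurePreserving_torusToCube.measurable.aemeasurable, measurePreserving_torusToCube.map_eq,
    ← integral_indicator measurableSet_cube, L2.inner_def]
  · refine integral_congr_ae ?_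
    filter_upwards [coeFn_mulOp (Mult.chi (intVec l)) (oneQ d), coeFn_oneQ (d := d)] with x h2 h3
    rw [h2, h3]
    by_cases hx : x ∈ cube d <;> simp [hx, Mult.chi, mul_comm]
  · rw [measurePreserving_torusToCube.map_eq]
    refine AEStronglyMeasurable.mul (Continuous.aestronglyMeasurable ?_)
      (Lp.aestronglyMeasurable q).restrict
    exact RCLike.continuous_conj.comp (by fun_prop)

/-- Parseval's identity for Fourier series on the unit cube. -/
theorem hasSum_parseval (p q : L2 d) :
    HasSum (fun l : Fin d → ℤ => inner ℂ p (mulOp (Mult.chi (intVec l)) (oneQ d)) *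
      inner ℂ (mulOp (Mult.chi (intVec l)) (oneQ d)) q) (inner ℂ p (mulOp (cubeM d) q)) := by
  have h := UnitAddTorus.hasSum_prod_mFourierCoeff ((memLp_torus p).toLp _)
    ((memLp_torus q).toLp _)
  have h1 : inner ℂ p (mulOp (cubeM d) q) = ∫ t, (starRingEnd ℂ) (((memLp_torus p).toLp _ :
      Lp ℂ 2 (volume : Measure (UnitAddTorus (Fin d)))) t) * ((memLp_torus q).toLp _ :
      Lp ℂ 2 (volume : Measure (UnitAddTorus (Fin d)))) t := by
    have h2 : ∫ t, (starRingEnd ℂ) (((memLp_torus p).toLp _ :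
      Lp ℂ 2 (volume : Measure (UnitAddTorus (Fin d)))) t) * ((memLp_torus q).toLp _ :
      Lp ℂ 2 (volume : Measure (UnitAddTorus (Fin d)))) t
      = ∫ t, (fun x : Rd d => (starRingEnd ℂ) (p x) * q x)
          (torusToCube (d := d) t) := by
      refine integral_congr_ae ?_
      filter_upwards [(memLp_torus p).coeFn_toLp, (memLp_torus q).coeFn_toLp] with t ht ht'
      rw [ht, ht']
    rw [h2, ← integral_map (f := fun x : Rd d => (starRingEnd ℂ) (p x) * q x)
      measurePreserving_torusToCube.measurable.aemeasurable, measurePreserving_torusToCube.map_eq,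
      ← integral_indicator measurableSet_cube, L2.inner_def]
    · refine integral_congr_ae ?_
      filter_upwards [coeFn_mulOp (cubeM d) q] with x h2
      rw [h2]
      by_cases hx : x ∈ cube d <;> simp [hx, cubeM, Mult.ind, mul_comm]
    · rw [measurePreserving_torusToCube.map_eq]
      exact ((RCLike.continuous_conj.comp_aestronglyMeasurable (Lp.aestronglyMeasurable p)).mul
        (Lp.aestronglyMeasurable q)).restrict
  rw [h1]
  refine h.congr_fun fun l => ?_
  rw [← inner_exp_oneQ, ← inner_exp_oneQ, inner_conj_symm]

end Parseval

/-! ### Abstract frames: the frame operator and a criterion for Riesz bases. -/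

section Frames

variable {ι H : Type*} [NormedAddCommGroup H] [InnerProductSpace ℂ H]

variable [CompleteSpace H]

/-- The frame operator of a frame, as a bounded operator together with its inverse. -/
theorem IsFrame.exists_frameOperator {f : ι → H} {a b : ℝ} (hf : IsFrame f a b) :
    ∃ F : H ≃L[ℂ] H, ∀ x y, HasSum (fun i => inner ℂ x (f i) * inner ℂ (f i) y) (inner ℂ x (F y)) := by
  obtain ⟨ha, hb, hfr⟩ := hf
  let A₀ : H →ₗ[ℂ] lp (fun _ : ι => ℂ) 2 :=
    { toFun := fun x => ⟨fun i => inner ℂ (f i) x, by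
        refine memℓp_gen ?_
        simpa using (hfr x).1⟩
      map_add' := fun x y => Subtype.ext (funext fun i => inner_add_right _ _ _)
      map_smul' := fun c x => Subtype.ext (funext fun i => inner_smul_right _ _ _) }
  have hnorm : ∀ x, ‖A₀ x‖ ^ 2 = ∑' i, ‖inner ℂ (f i) x‖ ^ 2 := fun x => by
    have := lp.norm_rpow_eq_tsum (p := 2) (by norm_num) (A₀ x)
    simpa [A₀] using this
  let A : H →L[ℂ] lp (fun _ : ι => ℂ) 2 := A₀.mkContinuous (√b) fun x => by
    refine abs_le_of_sq_le_sq' ?_ (by positivity) |>.2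
    rw [hnorm, mul_pow, Real.sq_sqrt hb.le]
    exact (hfr x).2.2
  let F₀ : H →L[ℂ] H := A.adjoint ∘L A
  have hF : ∀ x y, inner ℂ x (F₀ y) = inner ℂ (A x) (A y) := fun x y => by
    simp [F₀, ContinuousLinearMap.adjoint_inner_right]
  -- `F₀ = A* A` for the analysis operator `A`; the lower frame bound makes it coercive, hence
  -- invertible.
  have hunit : IsUnit F₀ := by
    refine ContinuousLinearMap.isUnit_of_forall_le_norm_inner_map F₀ (c := ⟨a, ha.le⟩) ha fun x => ?_
    rw [norm_inner_symm, hF, inner_self_eq_norm_sq_to_K]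
    simp only [norm_pow, RCLike.norm_ofReal, abs_norm]
    calc ‖x‖ ^ 2 * a = a * ‖x‖ ^ 2 := mul_comm _ _
      _ ≤ _ := (hfr x).2.1
      _ = ‖A x‖ ^ 2 := (hnorm x).symm
  obtain ⟨U, hU⟩ := hunit
  refine ⟨ContinuousLinearEquiv.ofUnit U, fun x y => ?_⟩
  have h1 : (ContinuousLinearEquiv.ofUnit U) y = F₀ y := by rw [← hU]; rfl
  rw [h1, hF]
  have := lp.hasSum_inner (𝕜 := ℂ) (A x) (A y)
  refine this.congr_fun fun i => ?_
  simp [A, A₀, mul_comm]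

theorem IsFrame.span_dense {f : ι → H} {a b : ℝ} (hf : IsFrame f a b) :
    (Submodule.span ℂ (Set.range f)).topologicalClosure = ⊤ := by
  rw [Submodule.topologicalClosure_eq_top_iff, Submodule.eq_bot_iff]
  intro x hx
  have h0 : ∀ i, inner ℂ (f i) x = 0 := fun i => hx _ (Submodule.subset_span ⟨i, rfl⟩)
  have h1 := (hf.2.2 x).2.1
  simp only [h0, norm_zero, ne_eq, OfNat.ofNat_ne_zero, not_false_eq_true, zero_pow, tsum_zero] at h1
  have h2 : ‖x‖ ^ 2 ≤ 0 := by
    by_contra h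
    push Not at h
    nlinarith [mul_pos hf.1 h]
  simpa using h2.antisymm (sq_nonneg _)

/-- A frame `f` with frame operator `F` for which `⟨f i, F⁻¹ f i⟩ = 1` for all `i` is a Riesz basis
with the same bounds. -/
theorem IsFrame.isRieszBasis {f : ι → H} {a b : ℝ} (hf : IsFrame f a b) (F : H ≃L[ℂ] H)
    (hF : ∀ x y, HasSum (fun i => inner ℂ x (f i) * inner ℂ (f i) y) (inner ℂ x (F y)))
    (h1 : ∀ i, inner ℂ (f i) (F.symm (f i)) = 1) : IsRieszBasis f a b := by
  have hfr := hf.2.2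
  have hsq : ∀ x, inner ℂ x (F x) = ((∑' i, ‖inner ℂ (f i) x‖ ^ 2 : ℝ) : ℂ) := fun x => by
    have h2 : HasSum (fun i => ((‖inner ℂ (f i) x‖ ^ 2 : ℝ) : ℂ)) (inner ℂ x (F x)) := by
      refine (hF x x).congr_fun fun i => ?_
      rw [← inner_conj_symm x, Complex.conj_mul']
      push_cast; rfl
    rw [Complex.ofReal_tsum]
    exact h2.tsum_eq.symm
  have hlow : ∀ x, a * ‖x‖ ^ 2 ≤ (inner ℂ x (F x)).re := fun x => by
    rw [hsq, Complex.ofReal_re]; exact (hfr x).2.1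
  have hup : ∀ x, (inner ℂ x (F x)).re ≤ b * ‖x‖ ^ 2 := fun x => by
    rw [hsq, Complex.ofReal_re]; exact (hfr x).2.2
  -- The squares `|⟨f i, F⁻¹ f j⟩|²` sum over `i` to `⟨F⁻¹ f j, f j⟩ = 1`, and the term `i = j`
  -- alone contributes 1.
  have hbi : ∀ i j, i ≠ j → inner ℂ (f i) (F.symm (f j)) = 0 := by
    intro i j hij
    classical
    have h3 := hsq (F.symm (f j))
    rw [F.apply_symm_apply, ← inner_conj_symm, h1, map_one] at h3
    have h3' : (∑' i, ‖inner ℂ (f i) (F.symm (f j))‖ ^ 2) = 1 := by exact_mod_cast h3.symm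
    have h4 := (hfr (F.symm (f j))).1.sum_le_tsum {i, j} (fun _ _ => sq_nonneg _)
    rw [h3', Finset.sum_pair hij, h1] at h4
    simp only [norm_one, one_pow] at h4
    have h5 : ‖inner ℂ (f i) (F.symm (f j))‖ ^ 2 ≤ 0 := by linarith
    simpa using h5.antisymm (sq_nonneg _)
  refine ⟨hf.1, hf.2.1, hf.span_dense, fun c => ?_⟩
  set v := ∑ i ∈ c.support, c i • f i with hv
  set S := ∑ i ∈ c.support, ‖c i‖ ^ 2 with hS
  have key : inner ℂ v (F.symm v) = (S : ℂ) := by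
    have h6 : F.symm v = ∑ i ∈ c.support, c i • F.symm (f i) := by simp [hv, map_sum]
    rw [h6, hv, sum_inner, hS]
    push_cast
    refine Finset.sum_congr rfl fun i hi => ?_
    rw [inner_sum, Finset.sum_eq_single i]
    · rw [inner_smul_left, inner_smul_right, h1, mul_one, Complex.conj_mul']
    · intro j _ hji
      rw [inner_smul_left, inner_smul_right, hbi i j hji.symm]; simp
    · exact fun h => absurd hi h
  set w := F.symm v with hw
  have hFw : F w = v := F.apply_symm_apply v
  have hre : (inner ℂ w v).re = S := by
    rw [← inner_conj_symm, key]; simp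
  have hSw : S ≤ ‖w‖ * ‖v‖ := by
    rw [← hre]; exact (Complex.re_le_norm _).trans (norm_inner_le_norm _ _)
  have hlw : a * ‖w‖ ^ 2 ≤ S := by simpa [hFw, hre] using hlow w
  constructor
  -- From `a‖w‖² ≤ S ≤ ‖w‖‖v‖` one gets `a‖w‖ ≤ ‖v‖`, hence `aS ≤ a‖w‖‖v‖ ≤ ‖v‖²`.
  · have h7 : a * ‖w‖ ≤ ‖v‖ := by
      rcases (norm_nonneg w).eq_or_lt with h | h
      · rw [← h]; simp
      · have : a * ‖w‖ * ‖w‖ ≤ ‖v‖ * ‖w‖ := by nlinarith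
        exact le_of_mul_le_mul_right this h
    nlinarith [norm_nonneg v, norm_nonneg w, hf.1, mul_le_mul_of_nonneg_right h7 (norm_nonneg v)]
  -- Cauchy–Schwarz and the upper frame bound give `‖v‖⁴ ≤ S · b‖v‖²`.
  · have h8 : ‖v‖ ^ 2 ≤ ∑ i ∈ c.support, ‖c i‖ * ‖inner ℂ (f i) v‖ := by
      have h9 : inner ℂ v v = ∑ i ∈ c.support, c i * inner ℂ v (f i) := by
        conv_lhs => rw [hv, inner_sum]
        simp only [inner_smul_right]; rfl
      have h10 : ‖v‖ ^ 2 = ‖inner ℂ v v‖ := by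
        rw [inner_self_eq_norm_sq_to_K]; simp
      rw [h10, h9]
      refine (norm_sum_le _ _).trans (le_of_eq (Finset.sum_congr rfl fun i _ => ?_))
      rw [norm_mul, norm_inner_symm]
    have h11 := Finset.sum_mul_sq_le_sq_mul_sq c.support (fun i => ‖c i‖)
      (fun i => ‖inner ℂ (f i) v‖)
    have h12 : ∑ i ∈ c.support, ‖inner ℂ (f i) v‖ ^ 2 ≤ b * ‖v‖ ^ 2 :=
      ((hfr v).1.sum_le_tsum _ (fun _ _ => sq_nonneg _)).trans (hfr v).2.2
    have hS0 : 0 ≤ S := Finset.sum_nonneg fun _ _ => sq_nonneg _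
    have h13 : (‖v‖ ^ 2) ^ 2 ≤ S * (b * ‖v‖ ^ 2) :=
      (pow_le_pow_left₀ (sq_nonneg _) h8 2).trans (h11.trans (mul_le_mul_of_nonneg_left h12 hS0))
    rcases (sq_nonneg ‖v‖).eq_or_lt with h | h
    · rw [← h]; exact mul_nonneg hf.2.1.le hS0
    · have : ‖v‖ ^ 2 * ‖v‖ ^ 2 ≤ (b * S) * ‖v‖ ^ 2 := by nlinarith
      exact le_of_mul_le_mul_right this h

end Frames

/-! ### Test functions on single cubes and correlations of windows. -/

section Test

variable {d : ℕ}

/-- The product of a multiplier and the indicator function of the cube `n + (0, 1]ᵈ`. -/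
def test (φ : Mult d) (n : Fin d → ℤ) : L2 d := translation (intVec n) (mulOp φ (oneQ d))

/-- Indicator multipliers give vanishing integrals over all measurable parts of each cube, so each
piece of the tiling vanishes. -/
theorem eq_zero_of_inner_test {x : L2 d} (h : ∀ φ n, inner ℂ (test φ n) x = 0) : x = 0 := by
  have h1 : ∀ n : Fin d → ℤ, mulOp (cubeM d) (translation (-intVec n) x) = 0 := by
    intro n
    set y := translation (-intVec n) x with hy
    have h2 : ∀ s, MeasurableSet s → volume s < ⊤ → ∫ x in s, mulOp (cubeM d) y x = 0 := by
      intro s hs _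
      have h3 := h (Mult.ind s hs) n
      rw [test, inner_translation_left, ← hy, L2.inner_def] at h3
      rw [← integral_indicator hs, ← h3]
      refine integral_congr_ae ?_
      filter_upwards [coeFn_mulOp (cubeM d) y, coeFn_mulOp (Mult.ind s hs) (oneQ d),
        coeFn_oneQ (d := d)] with x h4 h5 h6
      rw [h5, h6]
      by_cases hx : x ∈ s
      · rw [Set.indicator_of_mem hx, h4]
        by_cases hx' : x ∈ cube d <;> simp [hx, hx', cubeM, Mult.ind]
      · simp [hx, Mult.ind]
    have h3 := Lp.ae_eq_zero_of_forall_setIntegral_eq_zero (mulOp (cubeM d) y) two_ne_zero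
      ENNReal.ofNat_ne_top
      (fun s _ hμ => by
        have : IsFiniteMeasure (volume.restrict s) := ⟨by simpa using hμ⟩
        exact ((Lp.memLp _).restrict s).integrable one_le_two) h2
    exact (Lp.eq_zero_iff_ae_eq_zero).2 h3
  have h2 := hasSum_cube x x
  simp only [h1, inner_zero_left] at h2
  have h3 : inner ℂ x x = 0 := h2.unique hasSum_zero
  exact inner_self_eq_zero.1 h3

theorem inner_intVec (n l : Fin d → ℤ) : inner ℝ (intVec n) (intVec l) = ((n ⬝ᵥ l : ℤ) : ℝ) := by
  rw [EuclideanSpace.inner_eq_star_dotProduct]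
  simp [dotProduct, intVec, mul_comm]

theorem exp_neg_intVec (n l : Fin d → ℤ) :
    Complex.exp (2 * Real.pi * Complex.I * (inner ℝ (intVec n) (-intVec l) : ℝ)) = 1 := by
  rw [inner_neg_right, inner_intVec, Complex.exp_eq_one_iff]
  exact ⟨-(n ⬝ᵥ l), by push_cast; ring⟩

/-- The vector `h/2` for `h ∈ ℤᵈ/2ℤᵈ`. -/
def halfVec (h : Fin d → ZMod 2) : Rd d := (1 / 2 : ℝ) • intVec (rep h)

theorem exp_neg_halfVec (n : Fin d → ℤ) (h : Fin d → ZMod 2) :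
    Complex.exp (2 * Real.pi * Complex.I * (inner ℝ (intVec n) (-halfVec h) : ℝ))
      = sgn (dot2 n h) := by
  rw [halfVec, inner_neg_right, real_inner_smul_right, inner_intVec, ← cast_dotProduct_rep,
    ← neg_one_zpow_eq_sgn]
  have h1 : (2 * Real.pi * Complex.I * ((-(1 / 2 * ((n ⬝ᵥ rep h : ℤ) : ℝ)) : ℝ) : ℂ))
      = ((-(n ⬝ᵥ rep h) : ℤ) : ℂ) * (Real.pi * Complex.I) := by push_cast; ring
  rw [h1, Complex.exp_int_mul, Complex.exp_pi_mul_I, zpow_neg, ← inv_zpow]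
  norm_num

/-- The translate in the frequency domain is modulated. -/
theorem inner_test_chi (φ : Mult d) (n l : Fin d → ℤ) (h : Fin d → ZMod 2) (w : L2 d) :
    inner ℂ (test φ n) (mulOp (Mult.chi (-intVec l)) (mulOp (Mult.chi (-halfVec h)) w)) =
    sgn (dot2 n h) * inner ℂ (mulOp (Mult.chi (intVec l)) (oneQ d))
      (mulOp φ.conj (mulOp (Mult.chi (-halfVec h)) (translation (-intVec n) w))) := by
  rw [test, inner_translation_left, translation_mulOp, translation_mulOp, mulOp_chi_shift,
    mulOp_chi_shift, exp_neg_intVec, exp_neg_halfVec, one_smul, mulOp_smul,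
    inner_smul_right, inner_mulOp_left, inner_mulOp_left, Mult.chi_conj,
    mulOp_mulOp, mulOp_mulOp, mulOp_mulOp, mulOp_mulOp,
    Mult.mul_comm φ.conj]

theorem cubeM_conj : (cubeM d).conj = cubeM d := by
  ext x
  by_cases hx : x ∈ cube d <;> simp [Mult.conj, cubeM, Mult.ind, hx]

theorem cubeM_mul_cubeM : (cubeM d).mul (cubeM d) = cubeM d := by
  ext x
  by_cases hx : x ∈ cube d <;> simp [Mult.mul, cubeM, Mult.ind, hx]

/-- The correlation `∫_Q φ(ξ) w(ξ + n) conj (w'(ξ + m)) dξ` over the unit cube `Q`. -/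
def corr (φ : Mult d) (w w' : L2 d) (n m : Fin d → ℤ) : ℂ :=
  inner ℂ (mulOp (cubeM d) (translation (-intVec m) w'))
    (mulOp φ (mulOp (cubeM d) (translation (-intVec n) w)))

/-- Restricted to one cube, the sum over `l` is a Parseval sum. The two factors `χ(-h/2)` cancel in
it; only their constant phases at `n` and `m` survive, whence the sign. -/
theorem hasSum_test (φ₁ φ₂ : Mult d) (n m : Fin d → ℤ) (h : Fin d → ZMod 2) (w w' : L2 d) :
    HasSum (fun l : Fin d → ℤ =>
      inner ℂ (test φ₁ n) (mulOp (Mult.chi (-intVec l)) (mulOp (Mult.chi (-halfVec h)) w)) *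
      inner ℂ (mulOp (Mult.chi (-intVec l)) (mulOp (Mult.chi (-halfVec h)) w')) (test φ₂ m))
      (sgn (dot2 (n + m) h) * corr (φ₁.conj.mul φ₂) w w' n m) := by
  have h1 := (hasSum_parseval
    (mulOp φ₂.conj (mulOp (Mult.chi (-halfVec h)) (translation (-intVec m) w')))
    (mulOp φ₁.conj (mulOp (Mult.chi (-halfVec h)) (translation (-intVec n) w)))).mul_left
    (sgn (dot2 (n + m) h))
  have h2 : inner ℂ
      (mulOp φ₂.conj (mulOp (Mult.chi (-halfVec h)) (translation (-intVec m) w')))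
      (mulOp (cubeM d) (mulOp φ₁.conj (mulOp (Mult.chi (-halfVec h)) (translation (-intVec n) w))))
      = corr (φ₁.conj.mul φ₂) w w' n m := by
    rw [corr, inner_mulOp_left (cubeM d), inner_mulOp_left φ₂.conj, Mult.conj_conj, cubeM_conj,
      ← inner_mulOp_chi (-halfVec h) (translation (-intVec m) w')]
    congr 1
    simp only [mulOp_mulOp]
    congr 1
    have h3 : (cubeM d).mul ((φ₁.conj.mul φ₂).mul (cubeM d)) = (cubeM d).mul (φ₁.conj.mul φ₂) := by
      rw [Mult.mul_comm _ (cubeM d), ← Mult.mul_assoc, cubeM_mul_cubeM]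
    rw [h3]
    ext x
    simp only [Mult.mul]
    ring
  rw [h2] at h1
  refine h1.congr_fun fun l => ?_
  rw [inner_test_chi, ← inner_conj_symm _ (test φ₂ m), inner_test_chi, map_mul, conj_sgn,
    inner_conj_symm, dot2_add_left, sgn_add]
  ring

theorem corr_translation (φ : Mult d) (w w' : L2 d) (n m a b : Fin d → ℤ) :
    corr φ (translation (intVec a) w) (translation (intVec b) w') n m
      = corr φ w w' (n - a) (m - b) := by
  have h : ∀ (n a : Fin d → ℤ), (-intVec n + intVec a : Rd d) = -intVec (n - a) := fun n a => by
    ext j; simp [intVec]; ring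
  simp only [corr, translation_translation, h]

theorem corr_sum {κ : Type*} (s t : Finset κ) (φ : Mult d) (a b : κ → ℂ) (c c' : ℂ)
    (w w' : κ → L2 d) (n m : Fin d → ℤ) :
    corr φ (c • ∑ i ∈ s, a i • w i) (c' • ∑ j ∈ t, b j • w' j) n m
      = (starRingEnd ℂ) c' * c *
        ∑ i ∈ s, ∑ j ∈ t, a i * (starRingEnd ℂ) (b j) * corr φ (w i) (w' j) n m := by
  have h1 : ∀ (ψ : Mult d) (y : Rd d) (c : ℂ) (s : Finset κ) (a : κ → ℂ) (w : κ → L2 d),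
      mulOp ψ (translation y (c • ∑ i ∈ s, a i • w i))
        = c • ∑ i ∈ s, a i • mulOp ψ (translation y (w i)) := fun ψ y c s a w => by
    rw [← translationL_apply, ← mulOpL_apply]
    simp only [map_smul, map_sum]
    rfl
  have h2 : ∀ (ψ : Mult d) (c : ℂ) (s : Finset κ) (a : κ → ℂ) (w : κ → L2 d),
      mulOp ψ (c • ∑ i ∈ s, a i • w i) = c • ∑ i ∈ s, a i • mulOp ψ (w i) := fun ψ c s a w => by
    rw [← mulOpL_apply]
    simp only [map_smul, map_sum]
    rfl
  unfold corr
  rw [h1, h1, h2, inner_smul_left, inner_smul_right, inner_sum, mul_assoc]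
  congr 2
  refine Finset.sum_congr rfl fun i _ => ?_
  rw [sum_inner]
  refine Finset.sum_congr rfl fun j _ => ?_
  rw [inner_smul_left, inner_smul_right]
  ring

theorem norm_corr_le (φ : Mult d) (w w' : L2 d) (n m : Fin d → ℤ) :
    ‖corr φ w w' n m‖ ≤ ‖mulOp (cubeM d) (translation (-intVec n) w)‖ ^ 2 +
      ‖mulOp (cubeM d) (translation (-intVec m) w')‖ ^ 2 := by
  have h1 := norm_inner_le_norm (𝕜 := ℂ) (mulOp (cubeM d) (translation (-intVec m) w'))
    (mulOp φ (mulOp (cubeM d) (translation (-intVec n) w)))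
  have h2 := norm_mulOp_le φ (mulOp (cubeM d) (translation (-intVec n) w))
  have h3 := mul_le_mul_of_nonneg_left h2
    (norm_nonneg (mulOp (cubeM d) (translation (-intVec m) w')))
  unfold corr
  nlinarith [sq_nonneg (‖mulOp (cubeM d) (translation (-intVec n) w)‖ -
    ‖mulOp (cubeM d) (translation (-intVec m) w')‖),
    sq_nonneg ‖mulOp (cubeM d) (translation (-intVec n) w)‖,
    sq_nonneg ‖mulOp (cubeM d) (translation (-intVec m) w')‖]

theorem summable_norm_cube (w : L2 d) :
    Summable fun n : Fin d → ℤ => ‖mulOp (cubeM d) (translation (-intVec n) w)‖ ^ 2 := by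
  have h := (hasSum_cube w w).summable.norm
  refine h.congr fun n => ?_
  rw [inner_self_eq_norm_sq_to_K]
  simp

/-- A correlation is bounded by the energies of the two windows on the cubes involved, and by the
tiling these have finite total; injectivity ensures that no cube is counted twice. -/
theorem summable_corr (φ : Mult d) (w w' : L2 d) {a b : (Fin d → ℤ) → Fin d → ℤ}
    (ha : Function.Injective a) (hb : Function.Injective b) :
    Summable fun γ => corr φ w w' (a γ) (b γ) :=
  Summable.of_norm_bounded
    (((summable_norm_cube w).comp_injective ha).add ((summable_norm_cube w').comp_injective hb))
    fun _ => norm_corr_le _ _ _ _ _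

end Test

/-! ### Matrix coefficients of the (mixed) Wilson frame operator. -/

section Matrix

variable {d k : ℕ} {G : AddSubgroup (Fin d → ZMod 2)} {σ : Fin k → Fin d → ZMod 2}
  {I : G → Fin d → ℤ} {N : Set (Fin d → ℤ)}

/-- The coefficient `c_γ`. -/
def orbitCoeff (k : ℕ) (G : AddSubgroup (Fin d → ZMod 2)) (γ : Fin d → ℤ) : ℂ :=
  ((2 : ℝ) ^ k)⁻¹ * √((orbit G γ).ncard : ℝ)

open Classical in
/-- The Fourier transform of the unmodulated part of a Wilson function. -/
def wilsonSum (k : ℕ) (G : AddSubgroup (Fin d → ZMod 2)) (I : G → Fin d → ℤ)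
    (u : L2 d) (h : G) (γ : Fin d → ℤ) : L2 d :=
  orbitCoeff k G γ • ∑ τ : G, sgn (dot2 (I h + γ) τ.1) • translation (intVec (reflection τ.1 γ)) u

/-- The Fourier transform of a Wilson function. -/
def wilsonHat (k : ℕ) (G : AddSubgroup (Fin d → ZMod 2)) (I : G → Fin d → ℤ)
    (u : L2 d) (l : Fin d → ℤ) (h : G) (γ : Fin d → ℤ) : L2 d :=
  mulOp (Mult.chi (-intVec l)) (mulOp (Mult.chi (-halfVec h.1)) (wilsonSum k G I u h γ))

theorem conj_orbitCoeff_mul (γ : Fin d → ℤ) :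
    (starRingEnd ℂ) (orbitCoeff k G γ) * orbitCoeff k G γ
      = ((2 : ℂ) ^ k)⁻¹ * ((2 : ℂ) ^ k)⁻¹ * (orbit G γ).ncard := by
  have h : (orbitCoeff k G γ) = (((2 : ℝ) ^ k)⁻¹ * √((orbit G γ).ncard : ℝ) : ℝ) := by
    simp [orbitCoeff]
  rw [h, Complex.conj_ofReal, ← Complex.ofReal_mul]
  have h2 : (((2 : ℝ) ^ k)⁻¹ * √((orbit G γ).ncard : ℝ)) * (((2 : ℝ) ^ k)⁻¹ *
      √((orbit G γ).ncard : ℝ)) = ((2 : ℝ) ^ k)⁻¹ * ((2 : ℝ) ^ k)⁻¹ * (orbit G γ).ncard := by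
    have := Real.mul_self_sqrt (Nat.cast_nonneg (α := ℝ) (orbit G γ).ncard)
    linear_combination ((2 : ℝ) ^ k)⁻¹ * ((2 : ℝ) ^ k)⁻¹ * this
  rw [h2]
  push_cast
  rfl

-- Expanding both Wilson sums gives a double sum over `τ, τ'`. By `dot2_rho` the `h`-dependence is
-- the character of `ρ + τ + τ'`, so summing over `h` leaves only `τ' = ρ + τ`, with a factor `2^k`
-- that cancels one of the two `2^{-k}` in `c_γ²`.
open Classical in
theorem sum_corr_wilsonSum (hG : IsSeparableGroup G σ) (hI : IsDualityMap G σ I) (u v : L2 d)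
    (φ : Mult d) (n m γ : Fin d → ℤ) :
    ∑ h : G, sgn (dot2 (n + m) h.1) *
      corr φ (wilsonSum k G I u h γ) (wilsonSum k G I v h γ) n m
    = ((2 : ℂ) ^ k)⁻¹ * (orbit G γ).ncard * ∑ τ : G,
      sgn (dot2 (reflection τ.1 γ) (rho σ (n + m))) * corr φ u v (n - reflection τ.1 γ)
        (m - reflection (rho σ (n + m)) (reflection τ.1 γ)) := by
  set ρ : G := ⟨rho σ (n + m), hG.comb_mem _⟩ with hρ
  have h1 : ∀ h : G, sgn (dot2 (n + m) h.1) *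
      corr φ (wilsonSum k G I u h γ) (wilsonSum k G I v h γ) n m
      = ((2 : ℂ) ^ k)⁻¹ * ((2 : ℂ) ^ k)⁻¹ * (orbit G γ).ncard *
        ∑ τ : G, ∑ τ' : G, sgn (dot2 γ (τ + τ').1) *
          corr φ u v (n - reflection τ.1 γ) (m - reflection τ'.1 γ) *
          sgn (dot2 (I h) (ρ + (τ + τ')).1) := by
    intro h
    rw [wilsonSum, wilsonSum, corr_sum, conj_orbitCoeff_mul, mul_left_comm, Finset.mul_sum]
    congr 1
    refine Finset.sum_congr rfl fun τ _ => ?_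
    rw [Finset.mul_sum]
    refine Finset.sum_congr rfl fun τ' _ => ?_
    have hρ1 : dot2 (I h) ρ.1 = dot2 (n + m) h.1 := hI.dot2_rho hG (n + m) h
    rw [corr_translation, conj_sgn, AddSubgroup.coe_add G ρ, dot2_add_right (I h), hρ1]
    simp only [AddSubgroup.coe_add, dot2_add_right, dot2_add_left, sgn_add]
    ring
  simp only [h1]
  rw [← Finset.mul_sum, Finset.sum_comm]
  have h2 : ∀ τ : G, ∑ h : G, ∑ τ' : G, sgn (dot2 γ (τ + τ').1) *
          corr φ u v (n - reflection τ.1 γ) (m - reflection τ'.1 γ) *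
          sgn (dot2 (I h) (ρ + (τ + τ')).1) = 2 ^ k * (
      sgn (dot2 (reflection τ.1 γ) (rho σ (n + m))) * corr φ u v (n - reflection τ.1 γ)
        (m - reflection (rho σ (n + m)) (reflection τ.1 γ))) := by
    intro τ
    rw [Finset.sum_comm]
    simp only [← Finset.mul_sum, hI.sum_sgn hG (SetLike.coe_mem _)]
    have hself : ∀ x : G, x + x = 0 := fun x => Subtype.ext (add_self_eq_zero_of_two x.1)
    rw [Finset.sum_eq_single (ρ + τ)]
    · rw [if_pos, dot2_reflection, AddSubgroup.coe_add G ρ τ, reflection_add]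
      · have : τ + (ρ + τ) = ρ := by rw [add_left_comm, hself, add_zero]
        rw [this]; ring
      · have : ρ + (τ + (ρ + τ)) = 0 := by rw [add_left_comm τ, hself, add_zero, hself]
        rw [this]; rfl
    · intro τ' _ hne
      rw [if_neg, mul_zero]
      intro h0
      apply hne
      have h3 : (ρ + τ) + τ' = 0 := by rw [add_assoc]; exact Subtype.ext h0
      calc τ' = (ρ + τ) + ((ρ + τ) + τ') := by rw [← add_assoc, hself, zero_add]
        _ = ρ + τ := by rw [h3, add_zero]
    · simp
  simp only [h2]
  rw [← Finset.mul_sum]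
  have : (2 : ℂ) ^ k ≠ 0 := pow_ne_zero k two_ne_zero
  field_simp

theorem reflection_injective (τ : Fin d → ZMod 2) : Function.Injective (reflection (d := d) τ) :=
  Function.LeftInverse.injective (reflection_reflection τ)

theorem summable_sgn_corr (φ : Mult d) (u v : L2 d) (n m : Fin d → ℤ) (ρ : Fin d → ZMod 2) :
    Summable fun γ => sgn (dot2 γ ρ) * corr φ u v (n - γ) (m - reflection ρ γ) := by
  have h := (summable_corr φ u v (a := fun γ => n - γ) (b := fun γ => m - reflection ρ γ)
    sub_right_injective (sub_right_injective.comp (reflection_injective ρ))).norm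
  refine Summable.of_norm_bounded h fun γ => ?_
  rw [norm_mul]
  refine mul_le_of_le_one_left (norm_nonneg _) ?_
  unfold sgn; split_ifs <;> simp

/-- Summation in the order `l`, `h`, `γ ∈ N` uses `hasSum_test`, `sum_corr_wilsonSum` and
`hasSum_orbit`. Two windows are allowed because the case `u, u` describes the frame operator and the
case `F⁻¹ u, u` yields biorthogonality. -/
theorem hasSum_wilsonHat (hG : IsSeparableGroup G σ) (hI : IsDualityMap G σ I)
    (hN : ∀ x, (N ∩ orbit G x).ncard = 1) (u v : L2 d) (φ₁ φ₂ : Mult d) (n m : Fin d → ℤ) {s : ℂ}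
    (hs : HasSum (fun p : (Fin d → ℤ) × G × N =>
      inner ℂ (test φ₁ n) (wilsonHat k G I u p.1 p.2.1 p.2.2.1) *
      inner ℂ (wilsonHat k G I v p.1 p.2.1 p.2.2.1) (test φ₂ m)) s) :
    HasSum (fun γ => sgn (dot2 γ (rho σ (n + m))) *
      corr (φ₁.conj.mul φ₂) u v (n - γ) (m - reflection (rho σ (n + m)) γ)) s := by
  classical
  obtain ⟨s', hs'⟩ := summable_sgn_corr (φ₁.conj.mul φ₂) u v n m (rho σ (n + m))
  have h1 := hG.hasSum_orbit hN hs'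
  have h2 := ((Equiv.prodComm (G × N) (Fin d → ℤ)).hasSum_iff.2 hs).prod_fiberwise fun q =>
    hasSum_test φ₁ φ₂ n m q.1.1 (wilsonSum k G I u q.1 q.2.1) (wilsonSum k G I v q.1 q.2.1)
  have h3 := ((Equiv.prodComm N G).hasSum_iff.2 h2).prod_fiberwise fun γ => hasSum_fintype _
  have h4 : s = s' := by
    refine h3.unique (h1.congr_fun fun γ => ?_)
    exact sum_corr_wilsonSum hG hI u v (φ₁.conj.mul φ₂) n m γ.1
  rw [h4]
  exact hs'

end Matrix

/-! ### Commutation with unitaries, tested on cubes. -/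

section Commute

variable {d : ℕ}

/-- Translation as a unitary operator. -/
def translationE (y : Rd d) : L2 d ≃ₗᵢ[ℂ] L2 d :=
  LinearIsometryEquiv.ofSurjective (translationL y) fun f =>
    ⟨translation (-y) f, by
      rw [translationL_apply, translation_translation, add_neg_cancel, translation_zero]⟩

/-- Modulation as a unitary operator. -/
def chiE (y : Rd d) : L2 d ≃ₗᵢ[ℂ] L2 d :=
  LinearIsometryEquiv.ofSurjective
    ((mulOpL (Mult.chi y)).isometryOfInner (inner_mulOp_chi y)) fun f =>
    ⟨mulOp (Mult.chi (-y)) f, by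
      change mulOp (Mult.chi y) _ = f
      rw [mulOp_mulOp, Mult.chi_mul_chi, add_neg_cancel, mulOp_chi_zero]⟩

theorem translationE_apply (y : Rd d) (f : L2 d) : translationE y f = translation y f := rfl

theorem chiE_apply (y : Rd d) (f : L2 d) : chiE y f = mulOp (Mult.chi y) f := rfl

theorem dense_span_test : (Submodule.span ℂ (Set.range fun p : Mult d × (Fin d → ℤ) =>
    test p.1 p.2)).topologicalClosure = ⊤ := by
  rw [Submodule.topologicalClosure_eq_top_iff, Submodule.eq_bot_iff]
  intro x hx
  exact eq_zero_of_inner_test fun φ n => hx _ (Submodule.subset_span ⟨(φ, n), rfl⟩)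

theorem commute_of_inner_test (F : L2 d ≃L[ℂ] L2 d) (U : L2 d ≃ₗᵢ[ℂ] L2 d)
    (h : ∀ φ₁ φ₂ n m, inner ℂ (U (test φ₁ n)) (F (U (test φ₂ m)))
      = inner ℂ (test φ₁ n) (F (test φ₂ m))) (y : L2 d) : F (U y) = U (F y) := by
  have h1 : ∀ φ m, F (U (test φ m)) = U (F (test φ m)) := by
    intro φ m
    have h2 : U.symm (F (U (test φ m))) - F (test φ m) = 0 := by
      refine eq_zero_of_inner_test fun φ₁ n => ?_
      rw [inner_sub_right, ← h φ₁ φ n m, sub_eq_zero, ← U.inner_map_map, U.apply_symm_apply]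
    rw [← sub_eq_zero.1 h2, U.apply_symm_apply]
  have h3 : (F : L2 d →L[ℂ] L2 d) ∘L (U.toContinuousLinearEquiv : L2 d →L[ℂ] L2 d)
      = (U.toContinuousLinearEquiv : L2 d →L[ℂ] L2 d) ∘L (F : L2 d →L[ℂ] L2 d) := by
    refine ContinuousLinearMap.ext_on
      ((Submodule.dense_iff_topologicalClosure_eq_top).2 dense_span_test) ?_
    rintro _ ⟨p, rfl⟩
    exact h1 p.1 p.2
  exact DFunLike.congr_fun h3 y

theorem translationE_test (e n : Fin d → ℤ) (φ : Mult d) :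
    translationE (intVec e) (test φ n) = test φ (n + e) := by
  rw [translationE_apply, test, translation_translation, test]
  congr 1
  ext j; simp [intVec, add_comm]

theorem mulOp_chi_test (z : Rd d) (φ : Mult d) (n : Fin d → ℤ) :
    mulOp (Mult.chi z) (test φ n) =
      Complex.exp (2 * Real.pi * Complex.I * (inner ℝ (intVec n) z : ℝ)) •
        test ((Mult.chi z).mul φ) n := by
  have h1 := translation_mulOp (intVec n) (Mult.chi z) (test φ n)
  have h2 : translation (-intVec n) (test φ n) = mulOp φ (oneQ d) := by
    rw [test, translation_translation, neg_add_cancel, translation_zero]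
  rw [h2, mulOp_chi_shift, mulOp_mulOp] at h1
  have h3 := congrArg (translationL (intVec n)) h1
  rw [map_smul, translationL_apply, translation_translation, add_neg_cancel, translation_zero] at h3
  exact h3

end Commute

/-! ### Structure of the Wilson frame operator. -/

section Operator

variable {d k : ℕ} {G : AddSubgroup (Fin d → ZMod 2)} {σ : Fin k → Fin d → ZMod 2}
  {I : G → Fin d → ℤ} {N : Set (Fin d → ℤ)}

/-- Correlations of `u` with itself are invariant under exchanging coordinates in `S`. -/
def SwapInvariant (S : Set (Fin d)) (u : L2 d) : Prop :=
  ∀ (φ : Mult d) (n m n' m' : Fin d → ℤ), (∀ j ∈ S, n' j = m j ∧ m' j = n j) →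
    (∀ j ∉ S, n' j = n j ∧ m' j = m j) → corr φ u u n' m' = corr φ u u n m

/-- The operator `F` is the frame operator of the Wilson system of `u`, in the frequency domain. -/
def IsWilsonOperator (k : ℕ) (G : AddSubgroup (Fin d → ZMod 2)) (I : G → Fin d → ℤ)
    (N : Set (Fin d → ℤ)) (u : L2 d) (F : L2 d ≃L[ℂ] L2 d) : Prop :=
  ∀ x y, HasSum (fun p : (Fin d → ℤ) × G × N =>
      inner ℂ x (wilsonHat k G I u p.1 p.2.1 p.2.2.1) *
      inner ℂ (wilsonHat k G I u p.1 p.2.1 p.2.2.1) y) (inner ℂ x (F y))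

variable {u : L2 d} {F : L2 d ≃L[ℂ] L2 d}

theorem IsWilsonOperator.inner_symm (hF : IsWilsonOperator k G I N u F) (x y : L2 d) :
    inner ℂ x (F.symm y) = inner ℂ (F.symm x) y := by
  have h1 : ∀ x y, inner ℂ x (F y) = inner ℂ (F x) y := fun x y => by
    have h := (hF y x).map (starRingEnd ℂ) Complex.continuous_conj
    rw [inner_conj_symm] at h
    refine (hF x y).unique (h.congr_fun fun p => ?_)
    simp only [Function.comp_apply, map_mul, inner_conj_symm]
    ring
  conv_lhs => rw [← F.apply_symm_apply x]
  rw [← h1, F.apply_symm_apply]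

variable (hG : IsSeparableGroup G σ) (hI : IsDualityMap G σ I)
  (hN : ∀ x, (N ∩ orbit G x).ncard = 1)

include hG hI hN

theorem IsWilsonOperator.hasSum (hF : IsWilsonOperator k G I N u F) (φ₁ φ₂ : Mult d)
    (n m : Fin d → ℤ) : HasSum (fun γ => sgn (dot2 γ (rho σ (n + m))) *
      corr (φ₁.conj.mul φ₂) u u (n - γ) (m - reflection (rho σ (n + m)) γ))
      (inner ℂ (test φ₁ n) (F (test φ₂ m))) :=
  hasSum_wilsonHat hG hI hN u u φ₁ φ₂ n m (hF _ _)

/-- Some `σ i` pairs to 1 with `n + m`. Reindexing by `flip` on `supp (σ i)` preserves each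
correlation by swap invariance but reverses its sign, so the sum equals its own negative. -/
theorem IsWilsonOperator.inner_eq_zero (hF : IsWilsonOperator k G I N u F)
    (hu : ∀ i, SwapInvariant (supp (σ i)) u) (φ₁ φ₂ : Mult d) {n m : Fin d → ℤ}
    (h : rho σ (n + m) ≠ 0) : inner ℂ (test φ₁ n) (F (test φ₂ m)) = 0 := by
  classical
  have : ∃ i, dot2 (n + m) (σ i) ≠ 0 := by
    by_contra hc
    push Not at hc
    exact h (by simp [rho, comb, hc])
  obtain ⟨i, hi⟩ := this
  have hi1 : dot2 (n + m) (σ i) = 1 := (by decide : ∀ x : ZMod 2, x ≠ 0 → x = 1) _ hi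
  have hρ : ∀ j ∈ supp (σ i), rho σ (n + m) j = 1 := fun j hj => by
    rw [rho, hG.comb_apply _ hj, hi1]
  have h1 := hF.hasSum hG hI hN φ₁ φ₂ n m
  have h2 := ((flip_involutive (supp (σ i)) n m).toPerm.hasSum_iff.2 h1)
  have h3 := h1.neg
  have h4 : inner ℂ (test φ₁ n) (F (test φ₂ m)) = - inner ℂ (test φ₁ n) (F (test φ₂ m)) := by
    refine h2.unique (h3.congr_fun fun γ => ?_)
    simp only [Function.comp_apply, Function.Involutive.coe_toPerm]
    rw [hG.sgn_flip i hi1, neg_mul, hu i _ (n - γ) (m - reflection (rho σ (n + m)) γ)]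
    · intro j hj
      rw [sub_flip _ hρ, sub_reflection_flip _ hρ, if_pos hj, if_pos hj]
      exact ⟨rfl, rfl⟩
    · intro j hj
      rw [sub_flip _ hρ, sub_reflection_flip _ hρ, if_neg hj, if_neg hj]
      exact ⟨rfl, rfl⟩
  exact self_eq_neg.1 h4

theorem IsWilsonOperator.hasSum_of_rho (hF : IsWilsonOperator k G I N u F) (φ₁ φ₂ : Mult d)
    {n m : Fin d → ℤ} (h : rho σ (n + m) = 0) :
    HasSum (fun γ => corr (φ₁.conj.mul φ₂) u u (n - γ) (m - γ))
      (inner ℂ (test φ₁ n) (F (test φ₂ m))) := by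
  simpa [h] using hF.hasSum hG hI hN φ₁ φ₂ n m

/-- Shifting `n` and `m` by `e` changes `n + m` by `2e`, so `rho` is unchanged; in the sign-free
case the shift is absorbed by `γ ↦ γ + e`. -/
theorem IsWilsonOperator.commute_translation (hF : IsWilsonOperator k G I N u F)
    (hu : ∀ i, SwapInvariant (supp (σ i)) u) (e : Fin d → ℤ) (y : L2 d) :
    F (translationE (intVec e) y) = translationE (intVec e) (F y) := by
  refine commute_of_inner_test F _ (fun φ₁ φ₂ n m => ?_) y
  rw [translationE_test, translationE_test]
  have h1 : rho σ ((n + e) + (m + e)) = rho σ (n + m) := by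
    refine rho_congr fun j => ?_
    simp only [Pi.add_apply]
    push_cast
    have := CharTwo.add_self_eq_zero (e j : ZMod 2)
    linear_combination this
  by_cases h : rho σ (n + m) = 0
  · have h2 := hF.hasSum_of_rho hG hI hN φ₁ φ₂ h
    have h3 := (Equiv.addRight e).hasSum_iff.2
      (hF.hasSum_of_rho hG hI hN φ₁ φ₂ (h1.trans h))
    refine h3.unique (h2.congr_fun fun γ => ?_)
    simp only [Function.comp_apply, Equiv.coe_addRight, add_sub_add_right_eq_sub]
  · rw [hF.inner_eq_zero hG hI hN hu _ _ h, hF.inner_eq_zero hG hI hN hu _ _ (by rwa [h1])]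

/-- On cube functions `χ_z` acts by the constant `p n` and by a unimodular multiplier. The
multiplier cancels in `φ₁.conj.mul φ₂`, and the constants need to cancel only for pairs that `F`
couples. This admits `z = -h/2` as well as integer vectors. -/
theorem IsWilsonOperator.commute_chi (hF : IsWilsonOperator k G I N u F)
    (hu : ∀ i, SwapInvariant (supp (σ i)) u) (z : Rd d) (p : (Fin d → ℤ) → ℂ)
    (hp : ∀ n, Complex.exp (2 * Real.pi * Complex.I * (inner ℝ (intVec n) z : ℝ)) = p n)
    (hp1 : ∀ n m, rho σ (n + m) = 0 → (starRingEnd ℂ) (p n) * p m = 1) (y : L2 d) :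
    F (chiE z y) = chiE z (F y) := by
  refine commute_of_inner_test F _ (fun φ₁ φ₂ n m => ?_) y
  rw [chiE_apply, chiE_apply, mulOp_chi_test, mulOp_chi_test, hp, hp, map_smul, inner_smul_left,
    inner_smul_right, ← mul_assoc]
  by_cases h : rho σ (n + m) = 0
  · rw [hp1 n m h, one_mul]
    refine (hF.hasSum_of_rho hG hI hN _ _ h).unique
      ((hF.hasSum_of_rho hG hI hN _ _ h).congr_fun fun γ => ?_)
    have h2 : (((Mult.chi z).mul φ₁).conj.mul ((Mult.chi z).mul φ₂)) = φ₁.conj.mul φ₂ := by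
      ext x
      have h3 : (starRingEnd ℂ) ((Mult.chi z).1 x) * (Mult.chi z).1 x = 1 := by
        rw [Complex.conj_mul', show ‖(Mult.chi z).1 x‖ = 1 from norm_exp_inner x z]
        simp
      simp only [Mult.mul, Mult.conj, map_mul]
      linear_combination (starRingEnd ℂ) (φ₁.1 x) * φ₂.1 x * h3
    rw [h2]
  · rw [hF.inner_eq_zero hG hI hN hu _ _ h, hF.inner_eq_zero hG hI hN hu _ _ h, mul_zero]

theorem IsWilsonOperator.symm_wilsonSum (hF : IsWilsonOperator k G I N u F)
    (hu : ∀ i, SwapInvariant (supp (σ i)) u) (h : G) (γ : Fin d → ℤ) :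
    F.symm (wilsonSum k G I u h γ) = wilsonSum k G I (F.symm u) h γ := by
  rw [F.symm_apply_eq]
  simp only [wilsonSum, map_smul, map_sum]
  congr 1
  refine Finset.sum_congr rfl fun τ _ => ?_
  have := hF.commute_translation hG hI hN hu (reflection τ.1 γ) (F.symm u)
  rw [translationE_apply, translationE_apply, F.apply_symm_apply] at this
  rw [this]

theorem IsWilsonOperator.symm_wilsonHat (hF : IsWilsonOperator k G I N u F)
    (hu : ∀ i, SwapInvariant (supp (σ i)) u) (l : Fin d → ℤ) (h : G) (γ : Fin d → ℤ) :
    F.symm (wilsonHat k G I u l h γ) = wilsonHat k G I (F.symm u) l h γ := by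
  rw [F.symm_apply_eq, wilsonHat, wilsonHat]
  have h1 := hF.commute_chi hG hI hN hu (-intVec l) (fun _ => 1) (fun n => exp_neg_intVec n l)
    (fun n m _ => by simp)
  have h2 := hF.commute_chi hG hI hN hu (-halfVec h.1) (fun n => sgn (dot2 n h.1))
    (fun n => exp_neg_halfVec n h.1) (fun n m hnm => by
      rw [conj_sgn, ← sgn_add, ← dot2_add_left, ← hI.dot2_rho hG, hnm, dot2_zero_right, sgn_zero])
  simp only [chiE_apply] at h1 h2
  rw [h1, h2, ← hF.symm_wilsonSum hG hI hN hu, F.apply_symm_apply]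

end Operator

/-! ### Wexler–Raz relations and normalisation of the dual system. -/

section Duality

variable {d k : ℕ} {G : AddSubgroup (Fin d → ZMod 2)} {σ : Fin k → Fin d → ZMod 2}
  {I : G → Fin d → ℤ} {N : Set (Fin d → ℤ)} {u : L2 d} {F : L2 d ≃L[ℂ] L2 d}

theorem inner_oneQ_self : inner ℂ (oneQ d) (oneQ d) = 1 := by
  rw [oneQ, L2.inner_indicatorConstLp_one, ← oneQ, setIntegral_congr_ae (g := fun _ => (1 : ℂ))
    measurableSet_cube]
  · simp [Measure.real, volume_cube]
  · filter_upwards [coeFn_oneQ (d := d)] with x h hx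
    rw [h, Set.indicator_of_mem hx]

theorem inner_oneQ_translation {e : Fin d → ℤ} (he : e ≠ 0) :
    inner ℂ (oneQ d) (translation (intVec e) (oneQ d)) = 0 := by
  rw [L2.inner_def, ← integral_zero (Rd d) ℂ]
  refine integral_congr_ae ?_
  filter_upwards [coeFn_oneQ (d := d), coeFn_translation (intVec e) (oneQ d),
    ae_comp_sub (coeFn_oneQ (d := d)) (intVec e)] with x h1 h2 h3
  rw [h2, h3, h1]
  by_cases hx : x ∈ cube d
  · have : x - intVec e ∉ cube d := fun h => he <| by
      have := (existsUnique_cube x).unique (y₁ := 0) (y₂ := -e)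
        (by convert! hx using 1; ext j; simp [intVec])
        (by convert! h using 1; ext j; simp [intVec, sub_eq_add_neg])
      simpa using this.symm
    simp [this]
  · simp [hx]

/-- The biorthogonality relations of Wexler and Raz. -/
theorem IsWilsonOperator.inner_translation_symm (hG : IsSeparableGroup G σ)
    (hI : IsDualityMap G σ I) (hN : ∀ x, (N ∩ orbit G x).ncard = 1)
    (hF : IsWilsonOperator k G I N u F) (hu : ∀ i, SwapInvariant (supp (σ i)) u)
    {e : Fin d → ℤ} (he : ∀ j, (e j : ZMod 2) = 0) :
    inner ℂ (translation (-intVec e) u) (F.symm u) = if e = 0 then 1 else 0 := by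
  -- The frame expansion of `⟨F⁻¹ t₀, F t_e⟩ = ⟨t₀, t_e⟩` for the indicators `t₀, t_e` of two cubes.
  -- Moving `F⁻¹` onto the Wilson functions makes it a mixed sum with windows `F⁻¹ u` and `u`;
  -- evenness of `e` gives `ρ = 0`, and the sum over `γ` reassembles the inner product over the
  -- tiling.
  have h1 := hF (F.symm (test (Mult.chi 0) 0)) (test (Mult.chi 0) e)
  have h2 := hasSum_wilsonHat (k := k) hG hI hN (F.symm u) u (Mult.chi 0) (Mult.chi 0) 0 e
    (h1.congr_fun fun p => by
      rw [← hF.symm_wilsonHat hG hI hN hu, hF.inner_symm])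
  have hρ : rho σ (0 + e) = 0 := by
    have : rho σ (0 + e) = rho σ 0 := rho_congr fun j => by simp [he]
    rw [this]; simp [rho, comb, dot2]
  have hchi : ((Mult.chi 0).conj.mul (Mult.chi 0) : Mult d) = Mult.chi 0 := by
    rw [Mult.chi_conj, Mult.chi_mul_chi]; simp
  have hone : ∀ n : Fin d → ℤ, test (Mult.chi 0) n = translation (intVec n) (oneQ d) := fun n => by
    rw [test, mulOp_chi_zero]
  simp only [hρ, dot2_zero_right, sgn_zero, one_mul, reflection_zero, hchi] at h2
  rw [← hF.inner_symm] at h2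
  rw [F.symm_apply_apply, hone, hone] at h2
  have h3 := (Equiv.neg _).hasSum_iff.2 (hasSum_cube (translation (-intVec e) u) (F.symm u))
  have h4 : inner ℂ (translation (-intVec e) u) (F.symm u)
      = inner ℂ (translation (intVec 0) (oneQ d)) (translation (intVec e) (oneQ d)) := by
    refine h3.unique (h2.congr_fun fun γ => ?_)
    simp only [corr, mulOp_chi_zero, Function.comp_apply, Equiv.neg_apply, translation_translation,
      zero_sub]
    congr 3
    ext j; simp [intVec]; ring
  have h5 : (intVec 0 : Rd d) = 0 := by ext j; simp [intVec]
  rw [h4, h5, translation_zero]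
  split_ifs with h
  · rw [h, h5, translation_zero, inner_oneQ_self]
  · exact inner_oneQ_translation h

-- Reindexing the sum by a stabilizer element with sign `-1` turns the sum into its negative. Thus a
-- nonzero member has trivial signs on the stabilizer of `γ`.
open Classical in
theorem wilsonSum_eq_zero {h : G} {γ : Fin d → ℤ} {τ : G} (hτ : τ ∈ stabFinset G γ)
    (h1 : sgn (dot2 (I h + γ) τ.1) ≠ 1) : wilsonSum k G I u h γ = 0 := by
  have h2 : sgn (dot2 (I h + γ) τ.1) = -1 := by
    unfold sgn at h1 ⊢; split_ifs at h1 ⊢ <;> simp_all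
  rw [mem_stabFinset] at hτ
  set S := ∑ τ : G, sgn (dot2 (I h + γ) τ.1) • translation (intVec (reflection τ.1 γ)) u with hS
  have h3 : S = -S := by
    conv_lhs => rw [hS, ← Equiv.sum_comp (Equiv.addRight τ)]
    rw [hS, ← Finset.sum_neg_distrib]
    refine Finset.sum_congr rfl fun κ _ => ?_
    rw [Equiv.coe_addRight, AddSubgroup.coe_add, dot2_add_right, sgn_add, h2, reflection_add, hτ,
      mul_neg_one, neg_smul]
  have h4 : S = 0 := by
    have h5 : (2 : ℂ) • S = 0 := by
      rw [two_smul]; nth_rewrite 1 [h3]; exact neg_add_cancel S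
    exact (smul_eq_zero.1 h5).resolve_left two_ne_zero
  rw [wilsonSum, ← hS, h4, smul_zero]

/-- Differences of points in an orbit are even, so Wexler–Raz leaves only pairs with `R_τ γ = R_τ'
γ`, and for a nonzero member these carry sign 1. There are `2^k · |stab|` such pairs, and `c_γ² ·
2^k · |stab| = 1` by orbit-stabilizer. -/
theorem IsWilsonOperator.inner_wilsonHat_symm (hG : IsSeparableGroup G σ)
    (hI : IsDualityMap G σ I) (hN : ∀ x, (N ∩ orbit G x).ncard = 1)
    (hF : IsWilsonOperator k G I N u F) (hu : ∀ i, SwapInvariant (supp (σ i)) u)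
    {l : Fin d → ℤ} {h : G} {γ : Fin d → ℤ} (hne : wilsonHat k G I u l h γ ≠ 0) :
    inner ℂ (wilsonHat k G I u l h γ) (F.symm (wilsonHat k G I u l h γ)) = 1 := by
  classical
  have hstab : ∀ τ ∈ stabFinset G γ, sgn (dot2 (I h + γ) τ.1) = 1 := by
    intro τ hτ
    by_contra h1
    apply hne
    rw [wilsonHat, wilsonSum_eq_zero hτ h1]
    simp only [← mulOpL_apply, map_zero]
  rw [hF.symm_wilsonHat hG hI hN hu, wilsonHat, wilsonHat, inner_mulOp_chi, inner_mulOp_chi,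
    wilsonSum, wilsonSum, inner_smul_left, inner_smul_right, ← mul_assoc, conj_orbitCoeff_mul,
    sum_inner]
  have h1 : ∀ τ : G, inner ℂ (sgn (dot2 (I h + γ) τ.1) •
      translation (intVec (reflection τ.1 γ)) u) (∑ τ' : G, sgn (dot2 (I h + γ) τ'.1) •
      translation (intVec (reflection τ'.1 γ)) (F.symm u)) = (stabFinset G γ).card := by
    intro τ
    have h2 : ∀ τ' : G, inner ℂ (sgn (dot2 (I h + γ) τ.1) •
        translation (intVec (reflection τ.1 γ)) u) (sgn (dot2 (I h + γ) τ'.1) •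
        translation (intVec (reflection τ'.1 γ)) (F.symm u))
        = if reflection τ'.1 γ = reflection τ.1 γ then 1 else 0 := by
      intro τ'
      rw [inner_smul_left, inner_smul_right, conj_sgn,
        ← inner_translation_translation (-intVec (reflection τ'.1 γ)), translation_translation,
        translation_translation, neg_add_cancel, translation_zero]
      have h3 : (-intVec (reflection τ'.1 γ) + intVec (reflection τ.1 γ) : Rd d)
          = -intVec (reflection τ'.1 γ - reflection τ.1 γ) := by ext j; simp [intVec]; ring
      rw [h3, hF.inner_translation_symm hG hI hN hu (fun j => by simp [reflection_cast])]
      simp only [sub_eq_zero]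
      split_ifs with h4
      · have h5 : τ' + τ ∈ stabFinset G γ := by
          rw [mem_stabFinset, AddSubgroup.coe_add, add_comm, reflection_add, h4,
            reflection_reflection]
        have h6 := hstab _ h5
        rw [AddSubgroup.coe_add, dot2_add_right, sgn_add] at h6
        linear_combination h6
      · simp
    rw [inner_sum]
    simp only [h2]
    rw [Finset.sum_boole, card_reflection_fiber γ (Finset.mem_image_of_mem _ (Finset.mem_univ τ))]
  simp only [h1, Finset.sum_const, Finset.card_univ, nsmul_eq_mul]
  rw [← Nat.card_eq_fintype_card, hG.card_eq, ncard_orbit]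
  have h2 := hG.card_stab_mul_card_orbit (G := G) γ
  have h3 : (2 : ℂ) ^ k ≠ 0 := pow_ne_zero k two_ne_zero
  push_cast
  field_simp
  linear_combination h2

end Duality

/-! ### The Fourier transform on `L²`: translations, modulations, Gaussians. -/

section Fourier

variable {d : ℕ}

/-- The Fourier transform on `L²` is given by the Fourier integral on `L¹ ∩ L²`. -/
theorem fourier_toLp_ae_eq {f : Rd d → ℂ} (hf1 : Integrable f) (hf2 : MemLp f 2) :
    (𝓕 (hf2.toLp f) : L2 d) =ᵐ[volume] 𝓕 f := by
  have hcont : Continuous (𝓕 f) :=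
    VectorFourier.fourierIntegral_continuous Real.continuous_fourierChar
      (innerSL ℝ).continuous₂ hf1
  -- Both sides are compared against smooth compactly supported functions: the `L²` transform
  -- through tempered distributions, the integral through Fubini.
  refine ae_eq_of_integral_contDiff_smul_eq
    ((Lp.memLp _).locallyIntegrable one_le_two) hcont.locallyIntegrable fun g hg hgs => ?_
  have hgc : HasCompactSupport fun x => (g x : ℂ) := hgs.comp_left (g := ((↑) : ℝ → ℂ)) rfl
  let ψ : SchwartzMap (Rd d) ℂ := hgc.toSchwartzMap (Complex.ofRealCLM.contDiff.comp hg)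
  have h1 := DFunLike.congr_fun (Lp.fourier_toTemperedDistribution_eq (hf2.toLp f)) ψ
  rw [TemperedDistribution.fourier_apply, Lp.toTemperedDistribution_apply,
    Lp.toTemperedDistribution_apply] at h1
  have h2 : ∫ x, (𝓕 ψ : SchwartzMap (Rd d) ℂ) x • (hf2.toLp f) x
      = ∫ x, (𝓕 (ψ : Rd d → ℂ)) x • f x := by
    refine integral_congr_ae ?_
    filter_upwards [hf2.coeFn_toLp] with x hx
    rw [hx, SchwartzMap.fourier_coe]
  have h3 := VectorFourier.integral_fourierIntegral_smul_eq_flip (L := innerₗ (Rd d))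
    (f := (ψ : Rd d → ℂ)) (g := f) (μ := volume) (ν := volume) Real.continuous_fourierChar
    (innerSL ℝ).continuous₂ ψ.integrable hf1
  rw [flip_innerₗ] at h3
  calc ∫ x, g x • (𝓕 (hf2.toLp f) : L2 d) x = ∫ x, ψ x • (𝓕 (hf2.toLp f) : L2 d) x := rfl
    _ = ∫ x, (𝓕 (ψ : Rd d → ℂ)) x • f x := by rw [← h1, h2]
    _ = ∫ x, ψ x • 𝓕 f x := h3
    _ = ∫ x, g x • 𝓕 f x := rfl

theorem schwartz_induction {p : L2 d → Prop} (hp : IsClosed {f | p f})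
    (h : ∀ (f : Rd d → ℂ) (_ : Integrable f) (hf2 : MemLp f 2), p (hf2.toLp f)) (f : L2 d) :
    p f := by
  refine DenseRange.induction_on (SchwartzMap.denseRange_toLpCLM (E := Rd d) (F := ℂ) (p := 2)
    (μ := volume) ENNReal.ofNat_ne_top) f hp fun φ => ?_
  exact h φ φ.integrable (φ.memLp 2 volume)

theorem continuous_modulation (ω : Rd d) : Continuous (modulation (d := d) ω) :=
  ((mulOpL (Mult.chi ω)).isometryOfInner (inner_mulOp_chi ω)).continuous

theorem fourier_translation (y : Rd d) (f : L2 d) :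
    (𝓕 (translation y f) : L2 d) = modulation (-y) (𝓕 f) := by
  revert f
  refine schwartz_induction (isClosed_eq ?_ ?_) fun f hf1 hf2 => ?_
  · exact (Lp.fourierTransformₗᵢ (Rd d) ℂ).continuous.comp (translationL y).continuous
  · exact (continuous_modulation _).comp (Lp.fourierTransformₗᵢ (Rd d) ℂ).continuous
  have hf2' : MemLp (fun x => f (x - y)) 2 :=
    hf2.comp_measurePreserving (measurePreserving_sub_right volume y)
  have h1 : translation y (hf2.toLp f) = hf2'.toLp _ := by
    apply Lp.ext
    filter_upwards [coeFn_translation y (hf2.toLp f), ae_comp_sub hf2.coeFn_toLp y,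
      hf2'.coeFn_toLp] with x h1 h2 h3
    rw [h1, h2, h3]
  rw [h1]
  apply Lp.ext
  filter_upwards [fourier_toLp_ae_eq (hf1.comp_sub_right y) hf2', fourier_toLp_ae_eq hf1 hf2,
    coeFn_modulation (-y) (𝓕 (hf2.toLp f))] with w h2 h3 h4
  rw [h2, h4, h3, Real.fourier_eq', Real.fourier_eq', ← integral_const_mul]
  refine Eq.trans ?_ (integral_sub_right_eq_self _ y)
  refine integral_congr_ae (Filter.Eventually.of_forall fun x => ?_)
  simp only [smul_eq_mul]
  rw [← mul_assoc, ← Complex.exp_add]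
  congr 2
  rw [inner_sub_left, inner_neg_right, real_inner_comm w y]
  push_cast; ring

theorem fourier_modulation (ω : Rd d) (f : L2 d) :
    (𝓕 (modulation ω f) : L2 d) = translation ω (𝓕 f) := by
  revert f
  refine schwartz_induction (isClosed_eq ?_ ?_) fun f hf1 hf2 => ?_
  · exact (Lp.fourierTransformₗᵢ (Rd d) ℂ).continuous.comp (continuous_modulation ω)
  · exact (translationL ω).continuous.comp (Lp.fourierTransformₗᵢ (Rd d) ℂ).continuous
  have hmeas : AEStronglyMeasurable (fun x : Rd d =>
      Complex.exp (2 * Real.pi * Complex.I * (inner ℝ x ω : ℝ))) volume :=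
    Continuous.aestronglyMeasurable (by fun_prop)
  have hbd : ∀ᵐ x : Rd d, ‖Complex.exp (2 * Real.pi * Complex.I * (inner ℝ x ω : ℝ))‖ ≤ 1 :=
    Filter.Eventually.of_forall fun x => (norm_exp_inner x ω).le
  have hf1' : Integrable fun x => Complex.exp (2 * Real.pi * Complex.I * (inner ℝ x ω : ℝ)) * f x :=
    hf1.bdd_mul hmeas hbd
  have hf2' : MemLp (fun x => Complex.exp (2 * Real.pi * Complex.I * (inner ℝ x ω : ℝ)) * f x) 2 :=
    hf2.of_le (hmeas.mul hf2.1) (by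
      filter_upwards with x; rw [norm_mul, norm_exp_inner, one_mul])
  have h1 : modulation ω (hf2.toLp f) = hf2'.toLp _ := by
    apply Lp.ext
    filter_upwards [coeFn_modulation ω (hf2.toLp f), hf2.coeFn_toLp,
      hf2'.coeFn_toLp] with x h1 h2 h3
    rw [h1, h2, h3]
  rw [h1]
  apply Lp.ext
  filter_upwards [fourier_toLp_ae_eq hf1' hf2', ae_comp_sub (fourier_toLp_ae_eq hf1 hf2) ω,
    coeFn_translation ω (𝓕 (hf2.toLp f))] with w h2 h3 h4
  rw [h2, h4, h3, Real.fourier_eq', Real.fourier_eq']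
  refine integral_congr_ae (Filter.Eventually.of_forall fun x => ?_)
  simp only [smul_eq_mul]
  rw [← mul_assoc, ← Complex.exp_add]
  congr 2
  rw [inner_sub_right]
  push_cast; ring

/-- The Gaussian `e^{-π|x|²}`. -/
def gauss (x : Rd d) : ℂ := Complex.exp (-Real.pi * ‖x‖ ^ 2)

theorem integrable_gauss : Integrable (gauss (d := d)) := by
  have := GaussianFourier.integrable_cexp_neg_mul_sq_norm_add (V := Rd d) (b := Real.pi)
    (by simpa using Real.pi_pos) 0 0
  exact this.congr (Filter.Eventually.of_forall fun x => by simp [gauss])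

theorem norm_gauss_le (x : Rd d) : ‖gauss x‖ ≤ 1 := by
  rw [gauss, Complex.norm_exp, Real.exp_le_one_iff]
  have : (-Real.pi * ‖x‖ ^ 2 : ℂ) = ((-Real.pi * ‖x‖ ^ 2 : ℝ) : ℂ) := by push_cast; rfl
  rw [this, Complex.ofReal_re]
  nlinarith [Real.pi_pos, sq_nonneg ‖x‖, mul_nonneg Real.pi_pos.le (sq_nonneg ‖x‖)]

theorem continuous_gauss : Continuous (gauss (d := d)) := by unfold gauss; fun_prop

theorem memLp_gauss : MemLp (gauss (d := d)) 2 := by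
  rw [memLp_two_iff_integrable_sq_norm continuous_gauss.aestronglyMeasurable]
  refine integrable_gauss.mono (continuous_gauss.norm.pow 2).aestronglyMeasurable
    (Filter.Eventually.of_forall fun x => ?_)
  rw [norm_pow, norm_norm, sq]
  exact mul_le_of_le_one_left (norm_nonneg _) (norm_gauss_le x)

theorem fourier_gauss : (𝓕 (memLp_gauss.toLp (gauss (d := d))) : L2 d)
    = memLp_gauss.toLp (gauss (d := d)) := by
  apply Lp.ext
  filter_upwards [fourier_toLp_ae_eq (integrable_gauss (d := d)) memLp_gauss,
    (memLp_gauss (d := d)).coeFn_toLp] with w h1 h2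
  rw [h1, h2]
  have h3 := fourier_gaussian_innerProductSpace (V := Rd d) (b := Real.pi)
    (by simpa using Real.pi_pos) w
  have h4 : (Real.pi : ℂ) ≠ 0 := by exact_mod_cast Real.pi_ne_zero
  rw [div_self h4, Complex.one_cpow, one_mul] at h3
  refine h3.trans ?_
  rw [gauss]
  congr 1
  field_simp

/-- The Fourier transform of `u · e^{-π|·|²}` is a convolution with a Gaussian. -/
theorem integral_exp_gauss_mul (g : L2 d) (c : Rd d) :
    ∫ x, Complex.exp (2 * Real.pi * Complex.I * (inner ℝ x c : ℝ)) * (gauss x * (𝓕 g : L2 d) x)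
      = ∫ x, gauss (x - c) * g x := by
  have hg : ∀ x : Rd d, (starRingEnd ℂ) (gauss x) = gauss x := fun x => by
    rw [gauss, ← Complex.exp_conj]; simp
  have h1 := Lp.inner_fourier_eq (translation c (memLp_gauss.toLp (gauss (d := d)))) g
  rw [fourier_translation, fourier_gauss, L2.inner_def, L2.inner_def] at h1
  refine (integral_congr_ae ?_).trans (h1.trans (integral_congr_ae ?_))
  · filter_upwards [coeFn_modulation (-c) (memLp_gauss.toLp (gauss (d := d))),
      (memLp_gauss (d := d)).coeFn_toLp] with x h2 h3
    rw [h2, h3, RCLike.inner_apply, map_mul, hg, ← Complex.exp_conj]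
    have h4 : (starRingEnd ℂ) (2 * Real.pi * Complex.I * (inner ℝ x (-c) : ℝ))
        = 2 * Real.pi * Complex.I * (inner ℝ x c : ℝ) := by
      simp only [map_mul, Complex.conj_I, Complex.conj_ofReal, inner_neg_right, map_ofNat]
      push_cast; ring
    rw [h4]; ring
  · filter_upwards [coeFn_translation c (memLp_gauss.toLp (gauss (d := d))),
      ae_comp_sub (memLp_gauss (d := d)).coeFn_toLp c] with x h2 h3
    rw [h2, h3, RCLike.inner_apply, hg, mul_comm]

end Fourier

/-! ### Uniqueness for Fourier transforms of integrable functions. -/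

section Injectivity

variable {E : Type*} [NormedAddCommGroup E] [NormedSpace ℝ E] [CompleteSpace E]
  [MeasurableSpace E] [BorelSpace E] [SecondCountableTopology E]

/-- The Fourier transform of integrable real functions is injective. -/
theorem ae_eq_zero_of_integral_char_eq_zero {μ : Measure E} [SigmaFinite μ] {W : E → ℝ}
    (hW : Integrable W μ)
    (h : ∀ L : StrongDual ℝ E, ∫ v, Complex.exp (L v * Complex.I) * W v ∂μ = 0) :
    W =ᵐ[μ] 0 := by
  have hm : AEMeasurable W μ := hW.1.aemeasurable
  have hfin1 : IsFiniteMeasure (μ.withDensity fun x => ENNReal.ofReal (W x)) :=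
    isFiniteMeasure_withDensity_ofReal hW.2
  have hfin2 : IsFiniteMeasure (μ.withDensity fun x => ENNReal.ofReal (-W x)) :=
    isFiniteMeasure_withDensity_ofReal hW.neg.2
  have hint : ∀ (V : E → ℝ), Integrable V μ → ∀ L : StrongDual ℝ E,
      Integrable (fun v => (ENNReal.ofReal (V v)).toReal • Complex.exp (L v * Complex.I)) μ := by
    intro V hV L
    have h1 : Integrable (fun v => ((max (V v) 0 : ℝ) : ℂ)) μ := hV.pos_part.ofReal
    have h2 : Continuous fun v => Complex.exp (L v * Complex.I) := by fun_prop
    refine (h1.mul_bdd (c := 1) h2.aestronglyMeasurable ?_).congr ?_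
    · exact Filter.Eventually.of_forall fun v => (Complex.norm_exp_ofReal_mul_I _).le
    · exact Filter.Eventually.of_forall fun v => by
        simp [ENNReal.toReal_ofReal']
  -- The positive and negative parts of `W` define finite measures with equal characteristic
  -- functions.
  have heq : (μ.withDensity fun x => ENNReal.ofReal (W x))
      = μ.withDensity fun x => ENNReal.ofReal (-W x) := by
    refine Measure.ext_of_charFunDual (funext fun L => ?_)
    rw [charFunDual_apply, charFunDual_apply,
      integral_withDensity_eq_integral_toReal_smul₀ hm.ennreal_ofReal
        (Filter.Eventually.of_forall fun _ => ENNReal.ofReal_lt_top),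
      integral_withDensity_eq_integral_toReal_smul₀ (show AEMeasurable (fun x => -W x) μ from hm.neg).ennreal_ofReal
        (Filter.Eventually.of_forall fun _ => ENNReal.ofReal_lt_top), ← sub_eq_zero,
      ← integral_sub (hint W hW L) (hint (fun x => -W x) hW.neg L), ← h L]
    refine integral_congr_ae (Filter.Eventually.of_forall fun v => ?_)
    simp only [ENNReal.toReal_ofReal', Complex.real_smul]
    rw [← sub_mul, mul_comm, ← Complex.ofReal_sub]
    congr 2
    rcases le_total 0 (W v) with h0 | h0
    · rw [max_eq_left h0, max_eq_right (by linarith), sub_zero]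
    · rw [max_eq_right h0, max_eq_left (by linarith)]; ring
  have h3 := (withDensity_eq_iff_of_sigmaFinite hm.ennreal_ofReal hm.neg.ennreal_ofReal).1 heq
  filter_upwards [h3] with x hx
  rcases le_total 0 (W x) with h0 | h0
  · simp only [Pi.neg_apply, ENNReal.ofReal_of_nonpos (neg_nonpos.2 h0)] at hx
    exact le_antisymm (ENNReal.ofReal_eq_zero.1 hx) h0
  · simp only [Pi.neg_apply, ENNReal.ofReal_of_nonpos h0] at hx
    exact le_antisymm h0 (by simpa using ENNReal.ofReal_eq_zero.1 hx.symm)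

end Injectivity

/-! ### Exchange invariance, from `g ⊗ g` to correlations of `𝓕 g`. -/

section Swap

theorem measurePreserving_of_involutive_linear {E : Type*} [NormedAddCommGroup E]
    [NormedSpace ℝ E] [MeasurableSpace E] [BorelSpace E] [FiniteDimensional ℝ E] {μ : Measure E}
    [μ.IsAddHaarMeasure] (A : E →ₗ[ℝ] E) (hA : ∀ x, A (A x) = x) : MeasurePreserving A μ μ := by
  have h1 : LinearMap.det A * LinearMap.det A = 1 := by
    rw [← LinearMap.det_comp, show A ∘ₗ A = LinearMap.id from LinearMap.ext hA, LinearMap.det_id]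
  have h2 : LinearMap.det A ≠ 0 := left_ne_zero_of_mul_eq_one h1
  have h3 : |(LinearMap.det A)⁻¹| = 1 := by
    rw [abs_inv, inv_eq_one]
    have : |LinearMap.det A| * |LinearMap.det A| = 1 := by rw [abs_mul_abs_self, h1]
    nlinarith [abs_nonneg (LinearMap.det A)]
  refine ⟨A.continuous_of_finiteDimensional.measurable, ?_⟩
  rw [Measure.map_linearMap_addHaar_eq_smul_addHaar μ h2, h3]
  simp

variable {d : ℕ}

open Classical in
/-- The vector with the coordinates of `x` in `S` and those of `y` elsewhere. -/
def merge (S : Set (Fin d)) (x y : Rd d) : Rd d :=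
  WithLp.toLp 2 fun j => if j ∈ S then x j else y j

theorem merge_of_mem {S : Set (Fin d)} {j : Fin d} (hj : j ∈ S) (x y : Rd d) :
    merge S x y j = x j := by simp [merge, hj]

theorem merge_of_notMem {S : Set (Fin d)} {j : Fin d} (hj : j ∉ S) (x y : Rd d) :
    merge S x y j = y j := by simp [merge, hj]

/-- The exchange of the coordinates in `S` of two vectors. -/
def swapL (S : Set (Fin d)) : Rd d × Rd d →ₗ[ℝ] Rd d × Rd d where
  toFun p := (merge S p.2 p.1, merge S p.1 p.2)
  map_add' p q := by
    ext j <;> by_cases hj : j ∈ S <;> simp [merge, hj]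
  map_smul' c p := by
    ext j <;> by_cases hj : j ∈ S <;> simp [merge, hj]

theorem swapL_apply (S : Set (Fin d)) (x y : Rd d) :
    swapL S (x, y) = (merge S y x, merge S x y) := rfl

theorem swapL_swapL (S : Set (Fin d)) (p : Rd d × Rd d) : swapL S (swapL S p) = p := by
  ext j <;> by_cases hj : j ∈ S <;> simp [swapL, merge, hj]

theorem measurePreserving_swapL (S : Set (Fin d)) :
    MeasurePreserving (swapL S) (volume : Measure (Rd d × Rd d)) volume :=
  have : (volume : Measure (Rd d × Rd d)).IsAddHaarMeasure :=
    inferInstanceAs ((volume : Measure (Rd d)).prod (volume : Measure (Rd d))).IsAddHaarMeasure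
  measurePreserving_of_involutive_linear _ (swapL_swapL S)

theorem integral_comp_swapL (S : Set (Fin d)) (f : Rd d × Rd d → ℂ) :
    ∫ p, f (swapL S p) = ∫ p, f p :=
  (measurePreserving_swapL S).integral_comp' (f := MeasurableEquiv.ofInvolutive (swapL S)
    (swapL_swapL S) (measurePreserving_swapL S).measurable) f

theorem sum_swapL (S : Set (Fin d)) (f : Fin d → ℝ → ℝ → ℝ) (p q : Rd d × Rd d) :
    ∑ j, f j ((swapL S p).1 j) ((swapL S q).1 j) + ∑ j, f j ((swapL S p).2 j) ((swapL S q).2 j)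
      = ∑ j, f j (p.1 j) (q.1 j) + ∑ j, f j (p.2 j) (q.2 j) := by
  rw [← Finset.sum_add_distrib, ← Finset.sum_add_distrib]
  refine Finset.sum_congr rfl fun j _ => ?_
  by_cases hj : j ∈ S
  · simp [swapL, merge, hj, add_comm]
  · simp [swapL, merge, hj]

theorem inner_swapL (S : Set (Fin d)) (p q : Rd d × Rd d) :
    (inner ℝ (swapL S p).1 (swapL S q).1 : ℝ) + inner ℝ (swapL S p).2 (swapL S q).2
      = inner ℝ p.1 q.1 + inner ℝ p.2 q.2 := by
  simpa [PiLp.inner_apply] using sum_swapL S (fun _ a b => b * a) p q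

theorem gauss_swapL (S : Set (Fin d)) (p : Rd d × Rd d) :
    gauss (swapL S p).1 * gauss (swapL S p).2 = gauss p.1 * gauss p.2 := by
  have h := inner_swapL S p p
  simp only [real_inner_self_eq_norm_sq] at h
  simp only [gauss, ← Complex.exp_add]
  congr 1
  have h2 : (‖(swapL S p).1‖ ^ 2 + ‖(swapL S p).2‖ ^ 2 : ℂ) = ‖p.1‖ ^ 2 + ‖p.2‖ ^ 2 := by
    exact_mod_cast h
  linear_combination (-Real.pi : ℂ) * h2

/-- The tensor square of `u` is invariant under exchanging the coordinates in `S`. -/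
def TensorInvariant (S : Set (Fin d)) (u : Rd d → ℂ) : Prop :=
  ∀ᵐ p : Rd d × Rd d, u (swapL S p).1 * u (swapL S p).2 = u p.1 * u p.2

theorem ae_fst {P : Rd d → Prop} (h : ∀ᵐ x, P x) : ∀ᵐ p : Rd d × Rd d, P p.1 :=
  Measure.quasiMeasurePreserving_fst.ae h

theorem ae_snd {P : Rd d → Prop} (h : ∀ᵐ x, P x) : ∀ᵐ p : Rd d × Rd d, P p.2 :=
  Measure.quasiMeasurePreserving_snd.ae h

theorem ae_swapL (S : Set (Fin d)) {P : Rd d × Rd d → Prop} (h : ∀ᵐ p, P p) :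
    ∀ᵐ p, P (swapL S p) :=
  (measurePreserving_swapL S).quasiMeasurePreserving.ae h

theorem proj_merge_of_subset {S T : Set (Fin d)} (h : T ⊆ S) (x y : Rd d) :
    proj T (merge S x y) = proj T x :=
  funext fun j => merge_of_mem (h j.2) x y

theorem proj_merge_of_disjoint {S T : Set (Fin d)} (h : Disjoint T S) (x y : Rd d) :
    proj T (merge S x y) = proj T y :=
  funext fun j => merge_of_notMem (Set.disjoint_left.1 h j.2) x y

/-- The exchange swaps the arguments of the two copies of `g₁ i` and, supports being disjoint,
leaves every other factor alone. -/
theorem IsSeparableFun.tensorInvariant {k : ℕ} {G : AddSubgroup (Fin d → ZMod 2)}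
    {σ : Fin k → Fin d → ZMod 2} (hG : IsSeparableGroup G σ) {g : Rd d → ℂ}
    (hg : IsSeparableFun σ g) (i : Fin k) : TensorInvariant (supp (σ i)) g := by
  obtain ⟨g₀, g₁, h⟩ := hg
  filter_upwards [ae_fst h, ae_snd h, ae_swapL (supp (σ i)) (ae_fst h),
    ae_swapL (supp (σ i)) (ae_snd h)] with p h1 h2 h3 h4
  rw [h1, h2, h3, h4]
  obtain ⟨x, y⟩ := p
  have hd : Disjoint (⋃ i, supp (σ i))ᶜ (supp (σ i)) :=
    Set.disjoint_left.2 fun j hj hj' => hj (Set.mem_iUnion.2 ⟨i, hj'⟩)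
  simp only [swapL_apply, proj_merge_of_disjoint hd]
  suffices hP : (∏ l, g₁ l (proj _ (merge (supp (σ i)) y x))) *
      ∏ l, g₁ l (proj _ (merge (supp (σ i)) x y)) =
      (∏ l, g₁ l (proj _ x)) * ∏ l, g₁ l (proj _ y) by
    linear_combination g₀ (proj _ x) * g₀ (proj _ y) * hP
  rw [← Finset.prod_mul_distrib, ← Finset.prod_mul_distrib]
  refine Finset.prod_congr rfl fun l _ => ?_
  by_cases hl : l = i
  · subst hl
    rw [proj_merge_of_subset le_rfl, proj_merge_of_subset le_rfl, mul_comm]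
  · rw [proj_merge_of_disjoint (hG.supp_disjoint l i hl),
      proj_merge_of_disjoint (hG.supp_disjoint l i hl)]

/-- The Fourier transform preserves invariance of the tensor square, in the real case. -/
theorem TensorInvariant.fourier {S : Set (Fin d)} {g : L2 d} (hg : TensorInvariant S g)
    (hreal : ∀ᵐ ω, (𝓕 g : L2 d) ω = (starRingEnd ℂ) ((𝓕 g : L2 d) ω)) :
    TensorInvariant S (𝓕 g : L2 d) := by
  set u : L2 d := 𝓕 g with hu
  -- The Gaussian makes `u` integrable, so that its transform is a genuine integral, and being
  -- positive it can be divided out at the end. Reality of `u` makes `w` real, as the uniqueness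
  -- lemma demands.
  let w : Rd d → ℝ := fun x => Real.exp (-Real.pi * ‖x‖ ^ 2) * (u x).re
  have hgr : ∀ x : Rd d, gauss x = ((Real.exp (-Real.pi * ‖x‖ ^ 2) : ℝ) : ℂ) := fun x => by
    rw [gauss]; push_cast; rfl
  have hw : ∀ᵐ x, (w x : ℂ) = gauss x * u x := by
    filter_upwards [hreal] with x hx
    rw [hgr]
    simp only [w]
    rw [Complex.ofReal_mul, Complex.conj_eq_iff_re.1 hx.symm]
  have hwint : Integrable w := by
    have h1 : Integrable fun x => gauss x * u x := memLp_gauss.integrable_mul (Lp.memLp u)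
    refine h1.re.congr ?_
    filter_upwards [hw] with x hx
    rw [← hx]; simp
  have hW : Integrable (fun p : Rd d × Rd d => w p.1 * w p.2) := hwint.mul_prod hwint
  have hW' : Integrable (fun p : Rd d × Rd d => w (swapL S p).1 * w (swapL S p).2) :=
    (measurePreserving_swapL S).integrable_comp_of_integrable hW
  have hU : ∀ c : Rd d × Rd d, ∫ p : Rd d × Rd d, Complex.exp (2 * Real.pi * Complex.I *
      ((inner ℝ p.1 c.1 + inner ℝ p.2 c.2 : ℝ) : ℂ)) * ((w p.1 * w p.2 : ℝ) : ℂ)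
      = ∫ p : Rd d × Rd d, (gauss (p.1 - c.1) * gauss (p.2 - c.2)) * (g p.1 * g p.2) := by
    intro c
    have h1 : ∀ c : Rd d, ∫ x, Complex.exp (2 * Real.pi * Complex.I * (inner ℝ x c : ℝ)) * w x
        = ∫ x, gauss (x - c) * g x := fun c => by
      rw [← integral_exp_gauss_mul]
      refine integral_congr_ae ?_
      filter_upwards [hw] with x hx
      rw [hx]
    calc _ = ∫ p : Rd d × Rd d, (Complex.exp (2 * Real.pi * Complex.I * (inner ℝ p.1 c.1 : ℝ)) *
            w p.1) * (Complex.exp (2 * Real.pi * Complex.I * (inner ℝ p.2 c.2 : ℝ)) * w p.2) := by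
          refine integral_congr_ae (Filter.Eventually.of_forall fun p => ?_)
          simp only
          push_cast
          rw [mul_add, Complex.exp_add]
          ring
      _ = (∫ x, Complex.exp (2 * Real.pi * Complex.I * (inner ℝ x c.1 : ℝ)) * w x) *
            ∫ x, Complex.exp (2 * Real.pi * Complex.I * (inner ℝ x c.2 : ℝ)) * w x :=
          integral_prod_mul (μ := (volume : Measure (Rd d))) (ν := (volume : Measure (Rd d)))
            (fun x => Complex.exp (2 * Real.pi * Complex.I * (inner ℝ x c.1 : ℝ)) * (w x : ℂ))
            (fun x => Complex.exp (2 * Real.pi * Complex.I * (inner ℝ x c.2 : ℝ)) * (w x : ℂ))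
      _ = (∫ x, gauss (x - c.1) * g x) * ∫ x, gauss (x - c.2) * g x := by rw [h1, h1]
      _ = ∫ p : Rd d × Rd d, (gauss (p.1 - c.1) * g p.1) * (gauss (p.2 - c.2) * g p.2) :=
          (integral_prod_mul (μ := (volume : Measure (Rd d))) (ν := (volume : Measure (Rd d)))
            (fun x => gauss (x - c.1) * g x) (fun x => gauss (x - c.2) * g x)).symm
      _ = _ := by
          refine integral_congr_ae (Filter.Eventually.of_forall fun p => ?_)
          simp only
          ring
  -- The transform of `w ⊗ w` at `c` is `g ⊗ g` integrated against a Gaussian centred at `c`;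
  -- exchanging coordinates preserves `g ⊗ g` and moves the centre to `swapL S c`.
  have hUs : ∀ c : Rd d × Rd d, ∫ p : Rd d × Rd d, (gauss (p.1 - c.1) * gauss (p.2 - c.2)) *
      (g p.1 * g p.2) = ∫ p : Rd d × Rd d, (gauss (p.1 - (swapL S c).1) *
      gauss (p.2 - (swapL S c).2)) * (g p.1 * g p.2) := by
    intro c
    rw [← integral_comp_swapL S]
    refine integral_congr_ae ?_
    filter_upwards [hg] with p hp
    rw [hp]
    congr 1
    have h1 := gauss_swapL S (p - swapL S c)
    rw [map_sub, swapL_swapL] at h1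
    exact h1
  have hzero : (fun p : Rd d × Rd d => w p.1 * w p.2 - w (swapL S p).1 * w (swapL S p).2)
      =ᵐ[volume] 0 := by
    refine ae_eq_zero_of_integral_char_eq_zero (hW.sub hW') fun L => ?_
    obtain ⟨c, hc⟩ : ∃ c : Rd d × Rd d, ∀ p, (L p : ℂ) * Complex.I = 2 * Real.pi * Complex.I *
        ((inner ℝ p.1 c.1 + inner ℝ p.2 c.2 : ℝ) : ℂ) := by
      let b₁ := (InnerProductSpace.toDual ℝ (Rd d)).symm
        (L ∘L ContinuousLinearMap.inl ℝ (Rd d) (Rd d))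
      let b₂ := (InnerProductSpace.toDual ℝ (Rd d)).symm
        (L ∘L ContinuousLinearMap.inr ℝ (Rd d) (Rd d))
      refine ⟨((2 * Real.pi)⁻¹ • b₁, (2 * Real.pi)⁻¹ • b₂), fun p => ?_⟩
      have h1 : inner ℝ p.1 b₁ = L (p.1, 0) := by
        rw [real_inner_comm]; exact InnerProductSpace.toDual_symm_apply
      have h2 : inner ℝ p.2 b₂ = L (0, p.2) := by
        rw [real_inner_comm]; exact InnerProductSpace.toDual_symm_apply
      have h3 : L p = L (p.1, 0) + L (0, p.2) := by rw [← map_add]; simp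
      simp only [real_inner_smul_right, h1, h2, h3]
      have : (Real.pi : ℂ) ≠ 0 := by exact_mod_cast Real.pi_ne_zero
      push_cast
      field_simp
    simp only [hc]
    have hexp : Continuous fun p : Rd d × Rd d => Complex.exp (2 * Real.pi * Complex.I *
        ((inner ℝ p.1 c.1 + inner ℝ p.2 c.2 : ℝ) : ℂ)) := by fun_prop
    have hexpb : ∀ᵐ p : Rd d × Rd d, ‖Complex.exp (2 * Real.pi * Complex.I *
        ((inner ℝ p.1 c.1 + inner ℝ p.2 c.2 : ℝ) : ℂ))‖ ≤ 1 :=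
      Filter.Eventually.of_forall fun p => by
        rw [show (2 * Real.pi * Complex.I * ((inner ℝ p.1 c.1 + inner ℝ p.2 c.2 : ℝ) : ℂ) : ℂ)
          = ((2 * Real.pi * (inner ℝ p.1 c.1 + inner ℝ p.2 c.2) : ℝ) : ℂ) * Complex.I by
            push_cast; ring]
        exact (Complex.norm_exp_ofReal_mul_I _).le
    have h1 := hW.ofReal (𝕜 := ℂ) |>.bdd_mul hexp.aestronglyMeasurable hexpb
    have h2 := hW'.ofReal (𝕜 := ℂ) |>.bdd_mul hexp.aestronglyMeasurable hexpb
    calc _ = ∫ p : Rd d × Rd d, (Complex.exp (2 * Real.pi * Complex.I *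
            ((inner ℝ p.1 c.1 + inner ℝ p.2 c.2 : ℝ) : ℂ)) * ((w p.1 * w p.2 : ℝ) : ℂ)
          - Complex.exp (2 * Real.pi * Complex.I * ((inner ℝ p.1 c.1 + inner ℝ p.2 c.2 : ℝ) : ℂ)) *
            ((w (swapL S p).1 * w (swapL S p).2 : ℝ) : ℂ)) := by
          refine integral_congr_ae (Filter.Eventually.of_forall fun p => ?_)
          simp only [Complex.ofReal_sub, mul_sub]
      _ = _ := integral_sub h1 h2
      _ = 0 := by
          rw [sub_eq_zero, hU, hUs, ← hU, ← integral_comp_swapL S]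
          refine integral_congr_ae (Filter.Eventually.of_forall fun p => ?_)
          simp only [inner_swapL]
  filter_upwards [hzero, ae_fst hw, ae_snd hw, ae_swapL S (ae_fst hw), ae_swapL S (ae_snd hw)]
    with p h0 h1 h2 h3 h4
  have h5 : gauss (swapL S p).1 * u (swapL S p).1 * (gauss (swapL S p).2 * u (swapL S p).2)
      = gauss p.1 * u p.1 * (gauss p.2 * u p.2) := by
    rw [← h1, ← h2, ← h3, ← h4, ← Complex.ofReal_mul, ← Complex.ofReal_mul]
    exact congrArg _ (sub_eq_zero.1 h0).symm
  have hne : gauss p.1 * gauss p.2 ≠ 0 :=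
    mul_ne_zero (Complex.exp_ne_zero _) (Complex.exp_ne_zero _)
  refine mul_left_cancel₀ hne ?_
  linear_combination h5 - u (swapL S p).1 * u (swapL S p).2 * gauss_swapL S p

theorem TensorInvariant.swapInvariant {S : Set (Fin d)} {u : L2 d} (hu : TensorInvariant S u)
    (hreal : ∀ᵐ ω, u ω = (starRingEnd ℂ) (u ω)) : SwapInvariant S u := by
  intro φ n m n' m' hS hSc
  -- The pairs `(ξ + n, ξ + m)` form a null set, so the invariance cannot be restricted to them
  -- directly. A fixed `y` with `u y ≠ 0`, valid for almost every `x`, makes `u` a product of a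
  -- function of the `S`-coordinates and one of the others, and this can be shifted freely.
  have h1 : ∀ᵐ y : Rd d, ∀ᵐ x : Rd d, u (merge S y x) * u (merge S x y) = u x * u y :=
    Measure.ae_ae_of_ae_prod (Measure.measurePreserving_swap.quasiMeasurePreserving.ae hu)
  have key : ∀ᵐ ξ : Rd d, u (ξ + intVec n') * u (ξ + intVec m')
      = u (ξ + intVec n) * u (ξ + intVec m) := by
    by_cases h0 : ∀ᵐ y, u y = 0
    · have h2 : ∀ n : Fin d → ℤ, ∀ᵐ y, u (y + intVec n) = 0 := fun n => by
        have := ae_comp_sub h0 (-intVec n)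
        simpa using this
      filter_upwards [h2 n, h2 n'] with ξ h3 h4
      rw [h3, h4, zero_mul, zero_mul]
    · obtain ⟨y, hy0, hy⟩ := (Filter.not_eventually.1 h0).and_eventually h1 |>.exists
      have h2 : ∀ n : Fin d → ℤ, ∀ᵐ x : Rd d,
          u (merge S y (x + intVec n)) * u (merge S (x + intVec n) y) = u (x + intVec n) * u y :=
        fun n => by
          have := ae_comp_sub hy (-intVec n)
          simpa using this
      filter_upwards [h2 n, h2 m, h2 n', h2 m'] with ξ h3 h4 h5 h6
      have e1 : merge S (ξ + intVec n') y = merge S (ξ + intVec m) y := by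
        ext j; by_cases hj : j ∈ S <;> simp [merge, hj, intVec, hS]
      have e2 : merge S (ξ + intVec m') y = merge S (ξ + intVec n) y := by
        ext j; by_cases hj : j ∈ S <;> simp [merge, hj, intVec, hS]
      have e3 : merge S y (ξ + intVec n') = merge S y (ξ + intVec n) := by
        ext j; by_cases hj : j ∈ S <;> simp [merge, hj, intVec, hSc]
      have e4 : merge S y (ξ + intVec m') = merge S y (ξ + intVec m) := by
        ext j; by_cases hj : j ∈ S <;> simp [merge, hj, intVec, hSc]
      rw [e1, e3] at h5
      rw [e2, e4] at h6
      refine mul_right_cancel₀ (mul_ne_zero hy0 hy0) ?_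
      calc _ = (u (ξ + intVec n') * u y) * (u (ξ + intVec m') * u y) := by ring
        _ = (u (ξ + intVec n) * u y) * (u (ξ + intVec m) * u y) := by
          rw [← h3, ← h4, ← h5, ← h6]; ring
        _ = _ := by ring
  -- Reality removes the conjugation, so the integrand contains exactly the product treated in
  -- `key`.
  have hcorr : ∀ n m : Fin d → ℤ, corr φ u u n m = ∫ ξ, (cubeM d).1 ξ *
      (starRingEnd ℂ) ((cubeM d).1 ξ) * φ.1 ξ * (u (ξ + intVec n) * u (ξ + intVec m)) := by
    intro n m
    rw [corr, L2.inner_def]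
    refine integral_congr_ae ?_
    filter_upwards [coeFn_mulOp (cubeM d) (translation (-intVec m) u),
      coeFn_translation (-intVec m) u, coeFn_translation (-intVec n) u,
      coeFn_mulOp φ (mulOp (cubeM d) (translation (-intVec n) u)),
      coeFn_mulOp (cubeM d) (translation (-intVec n) u), ae_comp_sub hreal (-intVec m)]
      with ξ h1 h2 h3 h4 h5 h6
    rw [h1, h4, h5, h2, h3]
    simp only [RCLike.inner_apply, map_mul, sub_neg_eq_add]
    simp only [sub_neg_eq_add] at h6
    rw [← h6]
    ring
  rw [hcorr, hcorr]
  refine integral_congr_ae ?_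
  filter_upwards [key] with ξ hξ
  rw [hξ]

end Swap

/-! ### Transport between the time and frequency domains. -/

section Main

variable {d k : ℕ} {G : AddSubgroup (Fin d → ZMod 2)} {σ : Fin k → Fin d → ZMod 2}
  {I : G → Fin d → ℤ} {N : Set (Fin d → ℤ)}

theorem fourier_wilsonFun (g : L2 d) (l : Fin d → ℤ) (h : G) (γ : Fin d → ℤ) :
    (𝓕 (wilsonFun k G I g l h γ) : L2 d) = wilsonHat k G I (𝓕 g) l h γ := by
  classical
  rw [wilsonFun, fourier_translation, fourier_translation, wilsonHat, modulation_eq_mulOp,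
    modulation_eq_mulOp, wilsonSum]
  congr 2
  change Lp.fourierTransformₗᵢ (Rd d) ℂ _ = _
  rw [map_smul, map_sum]
  refine congrArg₂ _ rfl (Finset.sum_congr (by congr) fun τ _ => ?_)
  rw [map_smul, neg_one_zpow_eq_sgn, cast_dotProduct_rep]
  congr 1
  exact fourier_modulation _ g

/-- The frame operator of the Wilson system, conjugated with the Fourier transform. -/
theorem isWilsonOperator_conj {g : L2 d} {F : L2 d ≃L[ℂ] L2 d}
    (hF : ∀ x y, HasSum (fun i => inner ℂ x (wilsonSystem k G I N g i) *
      inner ℂ (wilsonSystem k G I N g i) y) (inner ℂ x (F y))) :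
    IsWilsonOperator k G I N (𝓕 g)
      (((Lp.fourierTransformₗᵢ (Rd d) ℂ).symm.toContinuousLinearEquiv.trans F).trans
        (Lp.fourierTransformₗᵢ (Rd d) ℂ).toContinuousLinearEquiv) := by
  intro x y
  set U := Lp.fourierTransformₗᵢ (Rd d) ℂ with hU
  have h1 : ∀ l h γ, wilsonHat k G I (𝓕 g) l h γ = U (wilsonFun k G I g l h γ) :=
    fun l h γ => (fourier_wilsonFun g l h γ).symm
  have h2 : inner ℂ x (((U.symm.toContinuousLinearEquiv.trans F).trans
      U.toContinuousLinearEquiv) y) = inner ℂ (U.symm x) (F (U.symm y)) := by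
    rw [← U.inner_map_map (U.symm x), U.apply_symm_apply]; rfl
  -- The discarded members are zero, so the sum may be extended to the full index set, over which
  -- the unfolding takes place.
  rw [h2, ← Function.Injective.hasSum_iff (Subtype.val_injective (p := fun p : (Fin d → ℤ) × G × N =>
    wilsonFun k G I g p.1 p.2.1 p.2.2.1 ≠ 0))]
  · refine (hF _ _).congr_fun fun p => ?_
    simp only [Function.comp_apply, h1]
    rw [← U.inner_map_map (U.symm x), ← U.inner_map_map _ (U.symm y), U.apply_symm_apply,
      U.apply_symm_apply]
    rfl
  · intro p hp
    have h3 : wilsonFun k G I g p.1 p.2.1 p.2.2.1 = 0 := by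
      by_contra h; exact hp ⟨⟨p, h⟩, rfl⟩
    rw [h1, h3, map_zero, inner_zero_right, zero_mul]

end Main

end Wilson

end

theorem mainTheorem3 {d k : ℕ} (G : AddSubgroup (Fin d → ZMod 2))
    (σ : Fin k → Fin d → ZMod 2) (hG : Wilson.IsSeparableGroup G σ)
    (I : G → Fin d → ℤ) (hI : Wilson.IsDualityMap G σ I)
    (N : Set (Fin d → ℤ)) (hN : ∀ x : Fin d → ℤ, (N ∩ Wilson.orbit G x).ncard = 1)
    (g : Wilson.L2 d) (hsep : Wilson.IsSeparableFun σ g)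
    (hreal : ∀ᵐ ω, (𝓕 g : Wilson.L2 d) ω = (starRingEnd ℂ) ((𝓕 g : Wilson.L2 d) ω))
    (a b : ℝ) (hframe : Wilson.IsFrame (Wilson.wilsonSystem k G I N g) a b) :
    Wilson.IsRieszBasis (Wilson.wilsonSystem k G I N g) a b := by
  obtain ⟨F, hF⟩ := hframe.exists_frameOperator
  have hW := Wilson.isWilsonOperator_conj hF
  have hu : ∀ i, Wilson.SwapInvariant (Wilson.supp (σ i)) (𝓕 g : Wilson.L2 d) := fun i =>
    ((hsep.tensorInvariant hG i).fourier hreal).swapInvariant hreal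
  refine hframe.isRieszBasis F hF fun p => ?_
  set U := Lp.fourierTransformₗᵢ (Wilson.Rd d) ℂ with hU
  have h1 : Wilson.wilsonHat k G I (𝓕 g) p.1.1 p.1.2.1 p.1.2.2.1
      = U (Wilson.wilsonSystem k G I N g p) := (Wilson.fourier_wilsonFun g _ _ _).symm
  have h2 := hW.inner_wilsonHat_symm hG hI hN hu (l := p.1.1) (h := p.1.2.1) (γ := p.1.2.2.1)
    (by rw [h1]; exact fun h => p.2 (U.map_eq_zero_iff.1 h))
  rw [h1] at h2
  have h3 : ((U.symm.toContinuousLinearEquiv.trans F).trans U.toContinuousLinearEquiv).symm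
      (U (Wilson.wilsonSystem k G I N g p)) = U (F.symm (Wilson.wilsonSystem k G I N g p)) := by
    rw [ContinuousLinearEquiv.symm_apply_eq]
    change _ = U (F (U.symm (U (F.symm _))))
    rw [U.symm_apply_apply, F.apply_symm_apply]
  rw [h3, U.inner_map_map] at h2
  exact h2
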